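/- **Theorem (Representation guarantee for DPSS vectors).** Let $N\ge 1$ be an integer and $W\in(0,\tfrac12)$. *Notation.* Let $\mathbf e_f=(e^{2\pi i f m})_{0\le m<N}\in\mathbb C^N$, and let $\mathbf F_{N,W}$ be the $N\times(2\lfloor NW\rfloor+1)$ matrix with columns $N^{-1/2}\mathbf e_{k/N}$, $-\lfloor NW\rfloor\le k\le\lfloor NW\rfloor$, and $\overline{\mathbf F}_{N,W}$ the $N\times M$ matrix, $M=N-2\lfloor NW\rfloor-1$, whose columns are the remaining normalized DFT vectors $N^{-1/2}\mathbf e_{k/N}$, $\lfloor NW\rfloor<k<N-\lfloor NW\rfloor$. Let $\mathbf B_{N,W}$ be the $N\times N$ prolate matrix with entries $\frac{\sin(2\pi W(m-n))}{\pi(m-n)}$ (equal to $2W$ for $m=n$). Let $s^{(0)},\dots,s^{(N-1)}\in\ell_2(\mathbb Z)$ be the discrete prolate spheroidal sequences: real sequences with $\mathcal B_W\mathcal T_N s^{(\ell)}=\lambda^{(\ell)}s^{(\ell)}$, $\lambda^{(0)}\ge\lambda^{(1)}\ge\dots\ge\lambda^{(N-1)}$, where $\mathcal T_N$ sets all entries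 outside $\{0,\dots,N-1\}$ to zero and $\mathcal B_W$ restricts the discrete-time Fourier transform to $[-W,W]$, such that the restrictions $\mathbf s^{(\ell)}\in\mathbb R^N$ of $s^{(\ell)}$ to $\{0,\dots,N-1\}$ (the DPSS vectors) are orthonormal. For $1\le K\le N$ let $\mathbf S_K=[\mathbf s^{(0)}\ \cdots\ \mathbf s^{(K-1)}]$. Put $C_N=\frac{4}{\pi^2}\log(8N)+6$ and let $\|\cdot\|$ be the spectral norm of a matrix. For nonzero subspaces $\mathcal S,\mathcal T$ of $\mathbb C^N$ with $\dim\mathcal S\le\dim\mathcal T$, the angle $\Theta\in[0,\tfrac{\pi}{2}]$ between them (the largest principal angle) is given by $\cos\Theta=\inf\{\|P_{\mathcal T}\mathbf a\|_2:\mathbf a\in\mathcal S,\ \|\mathbf a\|_2=1\}$, $P_{\mathcal T}$ being the orthogonal projection onto $\mathcal T$; if $\dim\mathcal S>\dim\mathcal T$ the roles are exchanged. *Claim.* Let $\epsilon\in(0,\tfrac12)$ and let $K\in\{1,\dots,N\}$ be such that $\lambda^{(K-1)}\ge\epsilon$. For a positive integer $R$ let $\mathbf V$ have as columns the $\min(R,M)$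 dominant left singular vectors of $\overline{\mathbf F}_{N,W}^*\mathbf B_{N,W}$ (the first columns of the left unitary factor of any singular value decomposition with nonincreasing singular values), and let $\mathbf Q=[\mathbf F_{N,W}\ \ \overline{\mathbf F}_{N,W}\mathbf V]$. 1. If $R=\lceil C_N\log(15/\epsilon)\rceil$, then $\mathbf Q$ has orthonormal columns, $$\|\mathbf S_K\mathbf S_K^*-\mathbf Q\mathbf Q^*\mathbf S_K\mathbf S_K^*\|^2\le\epsilon,\qquad \|\mathbf s^{(\ell)}-\mathbf Q\mathbf Q^*\mathbf s^{(\ell)}\|_2^2\le\epsilon\quad(\ell=0,\dots,K-1).$$ 2. If $R=\lceil C_N\log(15N/\epsilon)\rceil$, then $\mathbf Q$ has orthonormal columns and the angle $\Theta$ between the column spaces of $\mathbf S_K$ and $\mathbf Q$ satisfies $\cos\Theta\ge\sqrt{1-\epsilon}$. -/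

import Mathlib

namespace Slepian

open scoped Matrix

noncomputable section

/-- The sampled complex exponential `e_f = (exp (2πi f m))_{0 ≤ m < N}`. -/
def expVec (N : ℕ) (f : ℝ) (m : Fin N) : ℂ :=
  Complex.exp (2 * Real.pi * Complex.I * f * ((m : ℕ) : ℂ))

/-- The time-limiting operator: zero out all entries outside `{0, …, N - 1}`. -/
def timeLimit (N : ℕ) (x : ℤ → ℂ) (n : ℤ) : ℂ :=
  if 0 ≤ n ∧ n < (N : ℤ) then x n else 0

/-- The discrete-time Fourier transform `X(f) = ∑ₙ x[n] exp (-2πi f n)`.  It is only applied to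
time-limited signals below, for which the sum is finite. -/
def dtft (x : ℤ → ℂ) (f : ℝ) : ℂ :=
  ∑' n : ℤ, x n * Complex.exp (-(2 * Real.pi * Complex.I * f * (n : ℂ)))

/-- The band-limiting operator: the signal whose discrete-time Fourier transform agrees with that
of `x` on `[-W, W]` and vanishes on the rest of `[-1/2, 1/2]`. -/
def bandLimit (W : ℝ) (x : ℤ → ℂ) (m : ℤ) : ℂ :=
  ∫ f in (-W)..W, dtft x f * Complex.exp (2 * Real.pi * Complex.I * f * (m : ℂ))

/-- `s 0, …, s (N - 1)` are the discrete prolate spheroidal sequences, with eigenvalues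
`lam 0 ≥ … ≥ lam (N - 1)`: real square-summable eigensequences of band-limiting after
time-limiting, whose restrictions to `{0, …, N - 1}` are orthonormal.  (That the eigenvalues are
distinct and lie in `(0, 1)` is a consequence and is not required.) -/
structure IsDPSS (N : ℕ) (W : ℝ) (s : Fin N → ℤ → ℝ) (lam : Fin N → ℝ) : Prop where
  memlp : ∀ ℓ, Memℓp (s ℓ) 2
  eigen : ∀ ℓ (m : ℤ),
    bandLimit W (timeLimit N fun n => ((s ℓ n : ℝ) : ℂ)) m = (lam ℓ : ℂ) * ((s ℓ m : ℝ) : ℂ)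
  antitone : Antitone lam
  orthonormal : ∀ k ℓ,
    ∑ n : Fin N, s k ((n : ℕ) : ℤ) * s ℓ ((n : ℕ) : ℤ) = if k = ℓ then 1 else 0

/-- The DPSS vector: the restriction of a sequence to `{0, …, N - 1}`. -/
def dpssVec {N : ℕ} (s : Fin N → ℤ → ℝ) (ℓ : Fin N) (m : Fin N) : ℂ :=
  ((s ℓ ((m : ℕ) : ℤ) : ℝ) : ℂ)

/-- The `N × K` matrix `S_K` of the first `K` DPSS vectors. -/
def dpssMatrix {N K : ℕ} (s : Fin N → ℤ → ℝ) (hK : K ≤ N) : Matrix (Fin N) (Fin K) ℂ :=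
  Matrix.of fun m ℓ => dpssVec s (Fin.castLE hK ℓ) m

/-- The prolate matrix `B_{N,W}`, with the usual value `2W` on the diagonal. -/
def prolate (N : ℕ) (W : ℝ) : Matrix (Fin N) (Fin N) ℂ :=
  Matrix.of fun m n =>
    if m = n then ((2 * W : ℝ) : ℂ)
    else ((Real.sin (2 * Real.pi * W * (((m : ℕ) : ℝ) - ((n : ℕ) : ℝ))) /
      (Real.pi * (((m : ℕ) : ℝ) - ((n : ℕ) : ℝ))) : ℝ) : ℂ)

/-- The number `N - 2⌊NW⌋ - 1` of high-frequency DFT vectors. -/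
def numHigh (N : ℕ) (W : ℝ) : ℕ := N - 2 * ⌊(N : ℝ) * W⌋₊ - 1

/-- `F_{N,W}`: the normalized DFT vectors of frequencies `k / N`, `k = -⌊NW⌋, …, ⌊NW⌋`. -/
def lowDFT (N : ℕ) (W : ℝ) : Matrix (Fin N) (Fin (2 * ⌊(N : ℝ) * W⌋₊ + 1)) ℂ :=
  Matrix.of fun m j =>
    ((1 / Real.sqrt N : ℝ) : ℂ) * expVec N ((((j : ℕ) : ℝ) - (⌊(N : ℝ) * W⌋₊ : ℝ)) / N) m

/-- The remaining normalized DFT vectors, of frequencies `k / N`,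
`k = ⌊NW⌋ + 1, …, N - ⌊NW⌋ - 1` (frequencies are understood modulo `1`). -/
def highDFT (N : ℕ) (W : ℝ) : Matrix (Fin N) (Fin (numHigh N W)) ℂ :=
  Matrix.of fun m j =>
    ((1 / Real.sqrt N : ℝ) : ℂ) * expVec N (((⌊(N : ℝ) * W⌋₊ : ℝ) + 1 + ((j : ℕ) : ℝ)) / N) m

/-- `C_N = (4 / π²) log (8 N) + 6`. -/
def constC (N : ℕ) : ℝ := 4 / Real.pi ^ 2 * Real.log (8 * (N : ℝ)) + 6

/-- The columns of `V` are `r` dominant left singular vectors of `A`: they are the first `r`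
columns of `U` in some singular value decomposition `A = U Σ X*` with nonincreasing singular
values. -/
def IsDominantLeftSingularVectors {m n r : ℕ} (A : Matrix (Fin m) (Fin n) ℂ)
    (V : Matrix (Fin m) (Fin r) ℂ) : Prop :=
  ∃ (hr : r ≤ m) (U : Matrix (Fin m) (Fin m) ℂ) (X : Matrix (Fin n) (Fin n) ℂ) (σ : ℕ → ℝ),
    U ∈ Matrix.unitaryGroup (Fin m) ℂ ∧ X ∈ Matrix.unitaryGroup (Fin n) ℂ ∧
    Antitone σ ∧ (∀ i, 0 ≤ σ i) ∧
    A = U * (Matrix.of fun (i : Fin m) (j : Fin n) =>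
      if (i : ℕ) = (j : ℕ) then (σ i : ℂ) else 0) * Xᴴ ∧
    ∀ i j, V i j = U i (Fin.castLE hr j)

/-- `Q = [F_{N,W}  F̄_{N,W} V]`. -/
def roast (N : ℕ) (W : ℝ) {r : ℕ} (V : Matrix (Fin (numHigh N W)) (Fin r) ℂ) :
    Matrix (Fin N) (Fin (2 * ⌊(N : ℝ) * W⌋₊ + 1) ⊕ Fin r) ℂ :=
  Matrix.fromCols (lowDFT N W) (highDFT N W * V)

/-- The spectral (`ℓ²` operator) norm of a square matrix. -/
def opNorm {N : ℕ} (A : Matrix (Fin N) (Fin N) ℂ) : ℝ :=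
  ‖Matrix.toEuclideanCLM (n := Fin N) (𝕜 := ℂ) A‖

/-- The column space of a matrix. -/
def colSpace {N : ℕ} {ι : Type*} (A : Matrix (Fin N) ι ℂ) :
    Submodule ℂ (EuclideanSpace ℂ (Fin N)) :=
  Submodule.span ℂ (Set.range fun j => WithLp.toLp 2 fun i => A i j)

/-- `inf ‖P_T a‖` over the unit vectors `a` of `S`. -/
def infProj {N : ℕ} (S T : Submodule ℂ (EuclideanSpace ℂ (Fin N))) : ℝ :=
  sInf {x : ℝ | ∃ a ∈ S, ‖a‖ = 1 ∧ x = ‖T.starProjection a‖}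

/-- The subspace angle (largest principal angle): its cosine is the infimum of `‖P a‖` over the
unit vectors `a` of the subspace of smaller dimension, `P` being the orthogonal projection onto
the other subspace. -/
def subspaceAngle {N : ℕ} (S T : Submodule ℂ (EuclideanSpace ℂ (Fin N))) : ℝ :=
  Real.arccos
    (if Module.finrank ℂ S ≤ Module.finrank ℂ T then infProj S T else infProj T S)

end

end Slepian

namespace Slepian

open scoped Matrix ComplexConjugate

/-! ### A rational function that is small on `[1 / N, N]` -/

/-! Write `B`, `F̄`, `S`, `Q` for the prolate matrix, the high-frequency DFT matrix, `S_K` and `[F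
F̄V]`. The DPSS vectors are eigenvectors of `B` with eigenvalues at least `ε`, so a vector `S c`
equals `B (S d)` with `‖d‖ ≤ ‖c‖ / ε`. Since `[F F̄]` is unitary, `1 - Q Q* = F̄ (1 - V V*) F̄*`.
Both parts therefore follow from `‖(1 - V V*) F̄* B‖ ≤ ε ^ (3 / 2)`, a bound on a singular value of
`F̄* B`. By a min-max argument (`norm_one_sub_mul_mulVec_le`) it is enough to find `R` functionals
on whose common kernel the form `y F̄* B v` is that small.

The matrix `B` is the Gram matrix of the exponentials on `[-W, W]`. The form is thus an integral
over the band of a product of two trigonometric polynomials, the first being a combination, with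
coefficients `y`, of Dirichlet kernels centred at the high frequencies `x`. Up to factors depending
on `x` or `f` alone, such a kernel is `1 / sin (π (f - x))`. In the Möbius coordinate `μ = sinRatio
α` it becomes a Cauchy kernel `1 / (μ f - μ x)`, with `μ f < 0 < μ x`.

This calls for Zolotarev's device. For `r t = ∏ (t - p) / (t + p)` over `k` positive points, the
kernel multiplied by `1 - r (μ x) / r (μ f)` has rank `k` (`exists_dirichlet_mul_one_sub_eq_sum`).
On the kernel of the corresponding functionals, the polynomial equals `1 / r (μ f)` times the one
with coefficients `r (μ x) y`. Each factor contributes `ε ^ (3 / 4)`, because `|μ|` stays in `[1 /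
N, N]` and a geometric progression of about `log N · log (15 / ε)` points makes `r` that small there
(`exists_prod_abs_sub_div_add_le`). -/

lemma one_sub_le_one_add_mul_exp {q : ℝ} (h0 : 0 ≤ q) (h1 : q ≤ 1) :
    1 - q ≤ (1 + q) * Real.exp (-(2 * q)) := by
  rcases h1.eq_or_lt with rfl | h1
  · simp; positivity
  have hs := Real.hasSum_log_sub_log_of_abs_lt_one (x := q) (by rw [abs_of_nonneg h0]; exact h1)
  have h2 : 2 * q ≤ Real.log (1 + q) - Real.log (1 - q) := by
    have := hs.tsum_eq ▸ hs.summable.le_tsum 0 (fun j _ => by positivity)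
    simpa using this
  have h3 : (1 - q) = (1 + q) * Real.exp (-(Real.log (1 + q) - Real.log (1 - q))) := by
    rw [neg_sub, Real.exp_sub, Real.exp_log (by linarith), Real.exp_log (by linarith)]
    field_simp
  rw [h3]
  gcongr

/-- With `q = exp (-|u - t|)` the left side is `(1 - q) / (1 + q) = exp (-2 artanh q)`, and `artanh
q ≥ q`. In logarithmic coordinates this turns the product defining `r` into a sum of Laplace
kernels. -/
lemma abs_sub_div_add_exp_le (u t : ℝ) :
    |Real.exp u - Real.exp t| / (Real.exp u + Real.exp t) ≤
      Real.exp (-(2 * Real.exp (-|u - t|))) := by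
  wlog h : t ≤ u generalizing u t
  · have := this t u (le_of_not_ge h)
    rwa [abs_sub_comm, add_comm, abs_sub_comm t u] at this
  have hu := Real.exp_pos u
  have ht := Real.exp_pos t
  have hle : Real.exp t ≤ Real.exp u := Real.exp_le_exp.2 h
  rw [abs_of_nonneg (sub_nonneg.2 hle), abs_of_nonneg (sub_nonneg.2 h), div_le_iff₀ (by positivity)]
  have hq : Real.exp t = Real.exp u * Real.exp (-(u - t)) := by
    rw [← Real.exp_add]; ring_nf
  set q := Real.exp (-(u - t)) with hqdef
  have := one_sub_le_one_add_mul_exp (q := q) (Real.exp_pos _).le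
    (Real.exp_le_one_iff.2 (by linarith))
  rw [hq]
  nlinarith

/-- The distribution function `∫_{-∞}^s exp (-|τ|) dτ` of the two-sided exponential density. -/
noncomputable def laplaceCdf (s : ℝ) : ℝ := if s ≤ 0 then Real.exp s else 2 - Real.exp (-s)

/-- For `t ≥ 0` replace `exp (-|τ|)` by the larger `exp (-τ)` on `[t - h, t + h]`; its integral is
exactly the right side. The case `t ≤ 0` is symmetric. Strict loss occurs only when the interval
straddles `0`, where `2 ≤ exp s + exp (-s)` is used. -/
lemma laplaceCdf_sub_le (t : ℝ) {h : ℝ} (hh : 0 ≤ h) :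
    laplaceCdf (t + h) - laplaceCdf (t - h) ≤
      (Real.exp h - Real.exp (-h)) * Real.exp (-|t|) := by
  have key : ∀ s : ℝ, 2 ≤ Real.exp s + Real.exp (-s) := fun s => by
    have := Real.one_le_cosh s
    rw [Real.cosh_eq] at this; linarith
  have e1 := key (h - t)
  have e2 := key (h + t)
  unfold laplaceCdf
  rcases le_total 0 t with ht | ht
  · rw [abs_of_nonneg ht]
    split_ifs with h1 h2 h2
    · have : t = 0 := by linarith
      have : h = 0 := by linarith
      subst_vars; simp
    · linarith
    · rw [sub_mul, ← Real.exp_add, ← Real.exp_add]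
      ring_nf at *
      linarith
    · rw [sub_mul, ← Real.exp_add, ← Real.exp_add]
      ring_nf at *
      linarith
  · rw [abs_of_nonpos ht]
    split_ifs with h1 h2 h2
    · rw [sub_mul, ← Real.exp_add, ← Real.exp_add]
      ring_nf at *
      linarith
    · linarith
    · rw [sub_mul, ← Real.exp_add, ← Real.exp_add]
      ring_nf at *
      linarith
    · linarith

lemma two_mul_one_sub_exp_le_laplaceCdf_sub {a b d : ℝ} (hd : 0 < d) (ha : a ≤ -d) (hb : d ≤ b) :
    2 * (1 - Real.exp (-d)) ≤ laplaceCdf b - laplaceCdf a := by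
  unfold laplaceCdf
  rw [if_neg (by linarith), if_pos (by linarith)]
  have h1 : Real.exp a ≤ Real.exp (-d) := Real.exp_le_exp.2 ha
  have h2 : Real.exp (-b) ≤ Real.exp (-d) := Real.exp_le_exp.2 (by linarith)
  linarith

/-- Lower bound for the sum of `exp (-|u - t|)` over the `k` midpoints `t` of a grid of mesh `2 h`
centred at the origin. -/
lemma le_sum_exp_neg_abs_grid (k : ℕ) {h d u : ℝ} (hh : 0 < h) (hd : 0 < d)
    (hk : |u| + d ≤ k * h) :
    2 * (1 - Real.exp (-d)) ≤ (Real.exp h - Real.exp (-h)) *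
      ∑ j ∈ Finset.range k, Real.exp (-|u - ((2 * j + 1) * h - k * h)|) := by
  have hu := abs_le.1 (show |u| ≤ k * h - d by linarith)
  calc 2 * (1 - Real.exp (-d))
      ≤ laplaceCdf (k * h - u) - laplaceCdf (-(k * h) - u) :=
        two_mul_one_sub_exp_le_laplaceCdf_sub hd (by linarith) (by linarith)
    -- The cells of half-width `h` around the midpoints tile `[-k h, k h]`, so the increments
    -- telescope.
    _ = ∑ j ∈ Finset.range k, (laplaceCdf (2 * ((j + 1 : ℕ) : ℝ) * h - k * h - u) -
          laplaceCdf (2 * (j : ℝ) * h - k * h - u)) := by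
        rw [Finset.sum_range_sub (fun j : ℕ => laplaceCdf (2 * (j : ℝ) * h - k * h - u))]
        congr 2 <;> push_cast <;> ring
    _ ≤ _ := by
        rw [Finset.mul_sum]
        refine Finset.sum_le_sum fun j _ => ?_
        have := laplaceCdf_sub_le ((2 * j + 1) * h - k * h - u) hh.le
        rw [abs_sub_comm u]
        rwa [show (2 * j + 1) * h - k * h - u + h = 2 * ((j + 1 : ℕ) : ℝ) * h - k * h - u by
            push_cast; ring,
          show (2 * j + 1) * h - k * h - u - h = 2 * (j : ℝ) * h - k * h - u by ring] at this

lemma exp_sub_exp_neg_le {x : ℝ} (h1 : x < 1) :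
    Real.exp x - Real.exp (-x) ≤ 2 * x / (1 - x) := by
  have h2 : 1 - x ≤ Real.exp (-x) := by linarith [Real.add_one_le_exp (-x)]
  have h3 : Real.exp x ≤ 1 / (1 - x) := by
    rw [le_div_iff₀ (by linarith)]
    calc Real.exp x * (1 - x) ≤ Real.exp x * Real.exp (-x) := by gcongr
      _ = 1 := by rw [← Real.exp_add]; simp
  have h4 : 1 / (1 - x) - (1 - x) ≤ 2 * x / (1 - x) := by
    rw [← sub_nonneg]
    have : 2 * x / (1 - x) - (1 / (1 - x) - (1 - x)) = x ^ 2 / (1 - x) := by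
      have : 1 - x ≠ 0 := by linarith
      field_simp; ring
    rw [this]; exact div_nonneg (sq_nonneg _) (by linarith)
  linarith

lemma three_le_log_fifteen_div {ε : ℝ} (hε : ε ∈ Set.Ioo (0 : ℝ) (1 / 2)) :
    3 ≤ Real.log (15 / ε) := by
  rw [Real.le_log_iff_exp_le (div_pos (by norm_num) hε.1)]
  have h1 : Real.exp 3 ≤ 30 := by
    have := Real.exp_one_lt_d9
    calc Real.exp 3 = Real.exp 1 ^ 3 := by rw [← Real.exp_nat_mul]; norm_num
      _ ≤ 2.7182818286 ^ 3 := by gcongr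
      _ ≤ 30 := by norm_num
  refine h1.trans ?_
  rw [le_div_iff₀ hε.1]
  linarith [hε.2]

lemma two_and_half_le_log_fifteen : 2.5 ≤ Real.log 15 := by
  rw [Real.le_log_iff_exp_le (by norm_num)]
  have := Real.exp_one_lt_d9
  have h : Real.exp 2.5 ^ 2 ≤ 15 ^ 2 := by
    calc Real.exp 2.5 ^ 2 = Real.exp 1 ^ 5 := by
          rw [← Real.exp_nat_mul, ← Real.exp_nat_mul]; norm_num
      _ ≤ 2.7182818286 ^ 5 := by gcongr
      _ ≤ 15 ^ 2 := by norm_num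
  exact le_of_sq_le_sq h (by norm_num)

/-- The value `0.4` is a rational lower bound for `4 / π²`, and the reciprocal of the `5 / 2` used
for the mesh below; the `log 8` is given away. -/
lemma six_add_le_constC {N : ℕ} (hN : 1 ≤ N) : 0.4 * Real.log N + 6 ≤ constC N := by
  have hN' : (1 : ℝ) ≤ N := by exact_mod_cast hN
  have h1 : Real.log N ≤ Real.log (8 * N) := Real.log_le_log (by linarith) (by linarith)
  have h2 : (0.4 : ℝ) ≤ 4 / Real.pi ^ 2 := by
    rw [le_div_iff₀ (by positivity)]
    have := Real.pi_lt_d2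
    have := Real.pi_pos
    nlinarith
  have h3 := Real.log_nonneg hN'
  have : 0.4 * Real.log N ≤ 4 / Real.pi ^ 2 * Real.log (8 * N) := by gcongr
  unfold constC; linarith

lemma constC_mul_log_ge {N : ℕ} (hN : 1 ≤ N) {ε : ℝ} (hε : ε ∈ Set.Ioo (0 : ℝ) (1 / 2)) :
    18 ≤ constC N * Real.log (15 / ε) := by
  have h1 := six_add_le_constC hN
  have h2 := three_le_log_fifteen_div hε
  have h3 : 0 ≤ Real.log N := Real.log_nonneg (by exact_mod_cast hN)
  nlinarith

/-- There are `k` positive points `p` such that `∏ |y - p| / (y + p)` is at most `ε ^ (3 / 4)` on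
`[1 / N, N]`, as soon as `k + 2 ≥ C_N log (15 / ε)`. -/
lemma exists_prod_abs_sub_div_add_le {N k : ℕ} (hN : 1 ≤ N) {ε : ℝ}
    (hε : ε ∈ Set.Ioo (0 : ℝ) (1 / 2)) (hk : constC N * Real.log (15 / ε) ≤ k + 2) :
    ∃ p : ℕ → ℝ, (∀ j, 0 < p j) ∧ ∀ y : ℝ, 1 / (N : ℝ) ≤ y → y ≤ N →
      ∏ j ∈ Finset.range k, |y - p j| / (y + p j) ≤ ε ^ (3 / 4 : ℝ) := by
  have hN' : (1 : ℝ) ≤ N := by exact_mod_cast hN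
  set l := Real.log (15 / ε) with hl
  have hl3 : 3 ≤ l := three_le_log_fifteen_div hε
  have hl0 : 0 < l := by linarith
  have hlogN : 0 ≤ Real.log N := Real.log_nonneg hN'
  -- Half the logarithmic mesh. As `1 / h = 0.4 l`, the hypothesis on `k` lets the grid cover `[-log
  -- N, log N]` with margin `3` on each side. Since `2 (1 - e⁻³) ≥ 15 / 8`, the exponent satisfies
  -- `2 S ≥ (15 / 8) (1 - h) / h = (3 / 4) (l - 5 / 2)`, and `log 15 ≥ 5 / 2` absorbs the constant.
  set h : ℝ := 5 / 2 / l with hh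
  have hh0 : 0 < h := by positivity
  have hh1 : h < 1 := by rw [hh, div_lt_one hl0]; linarith
  have hkh : Real.log N + 3 ≤ k * h := by
    rw [hh, ← mul_div_assoc, le_div_iff₀ hl0]
    have := mul_le_mul_of_nonneg_right (six_add_le_constC hN) hl0.le
    nlinarith
  refine ⟨fun j => Real.exp ((2 * j + 1) * h - k * h), fun j => Real.exp_pos _, fun y hy1 hy2 => ?_⟩
  have hy0 : 0 < y := lt_of_lt_of_le (by positivity) hy1
  set u := Real.log y with hu
  have hyu : y = Real.exp u := (Real.exp_log hy0).symm
  have hau : |u| ≤ Real.log N := by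
    rw [abs_le]
    constructor
    · rw [← Real.log_inv, ← one_div]; exact Real.log_le_log (by positivity) hy1
    · exact Real.log_le_log hy0 hy2
  have hsum := le_sum_exp_neg_abs_grid k (u := u) hh0 (by norm_num : (0 : ℝ) < 3) (by linarith)
  set S := ∑ j ∈ Finset.range k, Real.exp (-|u - ((2 * j + 1) * h - k * h)|) with hS
  have hS0 : 0 ≤ S := Finset.sum_nonneg fun _ _ => (Real.exp_pos _).le
  have he3 : Real.exp (-3) ≤ 1 / 16 := by
    rw [Real.exp_neg, ← one_div]
    gcongr
    have := Real.exp_one_gt_d9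
    calc (16 : ℝ) ≤ 2.7182818283 ^ 3 := by norm_num
      _ ≤ Real.exp 1 ^ 3 := by gcongr
      _ = Real.exp 3 := by rw [← Real.exp_nat_mul]; norm_num
  have hS1 : 15 / 8 ≤ 2 * h / (1 - h) * S := by
    have := mul_le_mul_of_nonneg_right (exp_sub_exp_neg_le hh1) hS0
    linarith
  have hS2 : 15 / 8 * (1 - h) ≤ 2 * h * S := by
    rw [div_mul_eq_mul_div, le_div_iff₀ (by linarith)] at hS1
    linarith
  have hhl : h * l = 5 / 2 := by rw [hh]; field_simp
  have hS3 : 3 / 4 * (l - 5 / 2) ≤ 2 * S := by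
    have : 15 / 8 * (l - h * l) ≤ 2 * (h * l) * S := by nlinarith
    rw [hhl] at this; nlinarith
  have hlε : l = Real.log 15 - Real.log ε := Real.log_div (by norm_num) hε.1.ne'
  calc ∏ j ∈ Finset.range k, |y - Real.exp ((2 * j + 1) * h - k * h)| /
          (y + Real.exp ((2 * j + 1) * h - k * h))
      ≤ ∏ j ∈ Finset.range k, Real.exp (-(2 * Real.exp (-|u - ((2 * j + 1) * h - k * h)|))) := by
        rw [hyu]
        exact Finset.prod_le_prod (fun j _ => by positivity)
          fun j _ => abs_sub_div_add_exp_le _ _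
    _ = Real.exp (-(2 * S)) := by
        rw [← Real.exp_sum, Finset.sum_neg_distrib, Finset.mul_sum]
    _ ≤ ε ^ (3 / 4 : ℝ) := by
        rw [Real.rpow_def_of_pos hε.1]
        apply Real.exp_le_exp.2
        have := two_and_half_le_log_fifteen
        linarith

/-! ### Trigonometric polynomials and the prolate matrix -/

lemma expVec_mul_conj {N : ℕ} (f : ℝ) (m n : Fin N) :
    expVec N f m * conj (expVec N f n) =
      Complex.exp ((2 * Real.pi * Complex.I * (((m : ℕ) : ℂ) - ((n : ℕ) : ℂ))) * f) := by
  unfold expVec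
  rw [← Complex.exp_conj, ← Complex.exp_add]
  congr 1
  simp [Complex.conj_ofNat]
  ring

lemma continuous_expVec {N : ℕ} (m : Fin N) : Continuous fun f => expVec N f m := by
  unfold expVec; fun_prop

lemma integral_exp_eq_sin_div {W c : ℝ} (hc : c ≠ 0) :
    ∫ f in (-W)..W, Complex.exp ((2 * Real.pi * Complex.I * c) * f) =
      ((Real.sin (2 * Real.pi * W * c) / (Real.pi * c) : ℝ) : ℂ) := by
  have hpi : (Real.pi : ℂ) ≠ 0 := by exact_mod_cast Real.pi_ne_zero
  have hc' : (c : ℂ) ≠ 0 := by exact_mod_cast hc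
  rw [integral_exp_mul_complex (by simp [hc, Real.pi_ne_zero])]
  push_cast
  rw [Complex.sin]
  have e1 : 2 * (Real.pi : ℂ) * Complex.I * c * W = (2 * Real.pi * W * c) * Complex.I := by ring
  have e2 : 2 * (Real.pi : ℂ) * Complex.I * c * -W = -(2 * Real.pi * W * c) * Complex.I := by ring
  rw [e1, e2]
  field_simp
  rw [Complex.I_sq]
  ring

/-- This exhibits the prolate matrix as a Gram matrix of exponentials over the band. -/
lemma integral_expVec_mul_conj (N : ℕ) (W : ℝ) (m n : Fin N) :
    ∫ f in (-W)..W, expVec N f m * conj (expVec N f n) = prolate N W m n := by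
  simp_rw [expVec_mul_conj]
  by_cases h : m = n
  · subst h
    simp only [sub_self, mul_zero, zero_mul, Complex.exp_zero, prolate, Matrix.of_apply, if_true]
    simp [two_mul]
  · have hc : (((m : ℕ) : ℝ) - ((n : ℕ) : ℝ)) ≠ 0 := by
      rw [sub_ne_zero]; exact_mod_cast fun h' => h (Fin.ext h')
    have := integral_exp_eq_sin_div (W := W) hc
    push_cast at this
    rw [this]
    simp [prolate, h]

/-- Integration over a full period: this gives Parseval's identity as a special case of the band
integral. -/
lemma prolate_half (N : ℕ) : prolate N (1 / 2) = 1 := by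
  ext m n
  by_cases h : m = n
  · subst h; simp [prolate]
  · have : Real.sin (2 * Real.pi * (1 / 2) * (((m : ℕ) : ℝ) - ((n : ℕ) : ℝ))) = 0 := by
      rw [Real.sin_eq_zero_iff]
      exact ⟨(m : ℕ) - (n : ℕ), by push_cast; ring⟩
    simp only [prolate, Matrix.of_apply, h, if_false, this, zero_div, Matrix.one_apply_ne h]
    simp

/-- The trigonometric polynomial with coefficients `z`. -/
noncomputable def trigPoly {N : ℕ} (z : Fin N → ℂ) (f : ℝ) : ℂ := ∑ m, z m * expVec N f m

lemma continuous_trigPoly {N : ℕ} (z : Fin N → ℂ) : Continuous (trigPoly z) := by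
  unfold trigPoly
  have := fun m : Fin N => continuous_expVec m
  fun_prop

lemma integral_trigPoly_mul_conj {N : ℕ} (W : ℝ) (z w : Fin N → ℂ) :
    ∫ f in (-W)..W, trigPoly z f * conj (trigPoly w f) =
      ∑ m, ∑ n, z m * prolate N W m n * conj (w n) := by
  have hc := fun m : Fin N => continuous_expVec m
  have : ∀ f, trigPoly z f * conj (trigPoly w f) =
      ∑ m, ∑ n, z m * (expVec N f m * conj (expVec N f n)) * conj (w n) := fun f => by
    simp only [trigPoly, map_sum, map_mul, Finset.sum_mul_sum]
    refine Finset.sum_congr rfl fun m _ => Finset.sum_congr rfl fun n _ => by ring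
  simp_rw [this]
  have hci : ∀ m n : Fin N, Continuous fun f =>
      z m * (expVec N f m * conj (expVec N f n)) * conj (w n) := fun m n =>
    (continuous_const.mul ((hc m).mul (Complex.continuous_conj.comp (hc n)))).mul continuous_const
  rw [intervalIntegral.integral_finsetSum fun m _ =>
    (continuous_finsetSum _ fun n _ => hci m n).intervalIntegrable _ _]
  refine Finset.sum_congr rfl fun m _ => ?_
  rw [intervalIntegral.integral_finsetSum fun n _ => (hci m n).intervalIntegrable _ _]
  refine Finset.sum_congr rfl fun n _ => ?_
  rw [intervalIntegral.integral_mul_const, intervalIntegral.integral_const_mul,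
    integral_expVec_mul_conj]

lemma integral_norm_sq_trigPoly_half {N : ℕ} (z : Fin N → ℂ) :
    ∫ f in (-(1 / 2) : ℝ)..(1 / 2), ‖trigPoly z f‖ ^ 2 = ‖WithLp.toLp 2 z‖ ^ 2 := by
  have h := integral_trigPoly_mul_conj (1 / 2) z z
  simp_rw [prolate_half, Matrix.one_apply, Complex.mul_conj, Complex.normSq_eq_norm_sq] at h
  simp only [mul_ite, mul_one, mul_zero, ite_mul, zero_mul, Finset.sum_ite_eq, Finset.mem_univ,
    if_true, Complex.mul_conj, Complex.normSq_eq_norm_sq] at h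
  rw [intervalIntegral.integral_ofReal] at h
  rw [EuclideanSpace.norm_sq_eq]
  exact_mod_cast h

lemma integral_norm_sq_trigPoly_le {N : ℕ} {W : ℝ} (hW : W ∈ Set.Ioo (0 : ℝ) (1 / 2))
    (z : Fin N → ℂ) : ∫ f in (-W)..W, ‖trigPoly z f‖ ^ 2 ≤ ‖WithLp.toLp 2 z‖ ^ 2 := by
  rw [← integral_norm_sq_trigPoly_half]
  refine intervalIntegral.integral_mono_interval (by linarith [hW.2]) (by linarith [hW.1]) hW.2.le
    (Filter.Eventually.of_forall fun f => by positivity)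
    (((continuous_trigPoly z).norm.pow 2).intervalIntegrable _ _)

/-- Cauchy–Schwarz on the band, followed by enlarging the band to a full period. -/
lemma integral_norm_trigPoly_mul_le {N : ℕ} {W : ℝ} (hW : W ∈ Set.Ioo (0 : ℝ) (1 / 2))
    (z w : Fin N → ℂ) : ∫ f in (-W)..W, ‖trigPoly z f‖ * ‖trigPoly w f‖ ≤
      ‖WithLp.toLp 2 z‖ * ‖WithLp.toLp 2 w‖ := by
  have hle : -W ≤ W := by linarith [hW.1]
  have hm : ∀ u : Fin N → ℂ, MeasureTheory.MemLp (trigPoly u) (ENNReal.ofReal 2)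
      (MeasureTheory.volume.restrict (Set.Ioc (-W) W)) := fun u => by
    have h2 : ENNReal.ofReal 2 = 2 := by norm_num
    rw [h2, MeasureTheory.memLp_two_iff_integrable_sq_norm
      (continuous_trigPoly u).aestronglyMeasurable]
    exact (intervalIntegrable_iff_integrableOn_Ioc_of_le hle).1
      (((continuous_trigPoly u).norm.pow 2).intervalIntegrable _ _)
  have h := MeasureTheory.integral_mul_norm_le_Lp_mul_Lq Real.HolderConjugate.two_two (hm z) (hm w)
  simp_rw [← intervalIntegral.integral_of_le hle, Real.rpow_two, ← Real.sqrt_eq_rpow] at h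
  refine h.trans ?_
  gcongr
  · exact (Real.sqrt_le_left (norm_nonneg _)).2 (integral_norm_sq_trigPoly_le hW z)
  · exact (Real.sqrt_le_left (norm_nonneg _)).2 (integral_norm_sq_trigPoly_le hW w)

lemma dotProduct_prolate_mulVec {N : ℕ} (W : ℝ) (z v : Fin N → ℂ) :
    z ⬝ᵥ (prolate N W *ᵥ v) = ∫ f in (-W)..W, trigPoly z f * conj (trigPoly (star v) f) := by
  rw [integral_trigPoly_mul_conj]
  simp only [dotProduct, Matrix.mulVec, Finset.mul_sum, Pi.star_apply, RCLike.star_def,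
    Complex.conj_conj, mul_assoc]

lemma norm_toLp_star {N : ℕ} (v : Fin N → ℂ) : ‖WithLp.toLp 2 (star v)‖ = ‖WithLp.toLp 2 v‖ := by
  simp [EuclideanSpace.norm_eq]

/-- If a trigonometric polynomial is dominated on `[-W, W]` by another one, then so are the
corresponding functionals on the range of the prolate matrix. -/
lemma norm_dotProduct_prolate_mulVec_le {N : ℕ} {W : ℝ} (hW : W ∈ Set.Ioo (0 : ℝ) (1 / 2))
    {z z' : Fin N → ℂ} {δ : ℝ} (hδ : 0 ≤ δ)
    (h : ∀ f ∈ Set.Icc (-W) W, ‖trigPoly z f‖ ≤ δ * ‖trigPoly z' f‖) (v : Fin N → ℂ) :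
    ‖z ⬝ᵥ (prolate N W *ᵥ v)‖ ≤ δ * ‖WithLp.toLp 2 z'‖ * ‖WithLp.toLp 2 v‖ := by
  have hle : -W ≤ W := by linarith [hW.1]
  rw [dotProduct_prolate_mulVec]
  have hb := intervalIntegral.norm_integral_le_of_norm_le hle
    (f := fun f => trigPoly z f * conj (trigPoly (star v) f))
    (g := fun f => δ * (‖trigPoly z' f‖ * ‖trigPoly (star v) f‖)) (μ := MeasureTheory.volume)
    (Filter.Eventually.of_forall fun f hf => by
      rw [norm_mul, RCLike.norm_conj, ← mul_assoc]
      gcongr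
      exact h f ⟨hf.1.le, hf.2⟩)
    ((continuous_const.mul ((continuous_trigPoly z').norm.mul
      (continuous_trigPoly (star v)).norm)).intervalIntegrable _ _)
  refine hb.trans ?_
  rw [intervalIntegral.integral_const_mul, mul_assoc]
  gcongr
  rw [← norm_toLp_star v]
  exact integral_norm_trigPoly_mul_le hW z' (star v)

/-! ### The Dirichlet kernel -/

/-- The Dirichlet kernel `⟨e_x, e_f⟩`. -/
noncomputable def dirichlet (N : ℕ) (x f : ℝ) : ℂ := trigPoly (star (expVec N x)) f

/-- Sum the geometric series. Because `N x` is an integer, its numerator does not depend on `x`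
through the `N`-th power, so the right side separates into a function of `x` times a function of
`f`. -/
lemma dirichlet_mul_sin {N : ℕ} (k : ℤ) (x f : ℝ) (hx : N * x = k) :
    dirichlet N x f * Real.sin (Real.pi * (f - x)) =
      Complex.exp (Real.pi * Complex.I * x) *
        (Complex.exp (-(Real.pi * Complex.I * f)) *
          (Complex.exp (2 * Real.pi * Complex.I * f * N) - 1) / (2 * Complex.I)) := by
  set w := Complex.exp (2 * Real.pi * Complex.I * (f - x)) with hw
  have h1 : dirichlet N x f = ∑ m ∈ Finset.range N, w ^ m := by
    rw [dirichlet, trigPoly, Finset.sum_range]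
    refine Finset.sum_congr rfl fun m _ => ?_
    rw [hw, ← Complex.exp_nat_mul, Pi.star_apply, expVec, expVec, RCLike.star_def,
      ← Complex.exp_conj, ← Complex.exp_add]
    congr 1
    simp [Complex.conj_ofNat]
    ring
  have h2 : w ^ N = Complex.exp (2 * Real.pi * Complex.I * f * N) := by
    rw [hw, ← Complex.exp_nat_mul, Complex.exp_eq_exp_iff_exists_int]
    have hx' : (N : ℂ) * x = k := by exact_mod_cast hx
    refine ⟨-k, ?_⟩
    push_cast
    rw [← hx']
    ring
  have h3 : (Real.sin (Real.pi * (f - x)) : ℂ) =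
      Complex.exp (Real.pi * Complex.I * x) * Complex.exp (-(Real.pi * Complex.I * f)) *
        (w - 1) / (2 * Complex.I) := by
    push_cast
    rw [Complex.sin, ← Complex.exp_add, hw, mul_sub (Complex.exp _), ← Complex.exp_add, mul_one]
    have e1 : Real.pi * Complex.I * x + -(Real.pi * Complex.I * f) +
      2 * Real.pi * Complex.I * (f - x) = Real.pi * (f - x) * Complex.I := by ring
    have e2 : Real.pi * Complex.I * x + -(Real.pi * Complex.I * f) =
      -(Real.pi * (f - x)) * Complex.I := by ring
    rw [e1, e2]
    field_simp
    rw [Complex.I_sq]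
    ring
  rw [h1, h3, ← h2, ← geom_sum_mul w N]
  ring

lemma one_sub_prod_range (c : ℕ → ℝ) (k : ℕ) :
    1 - ∏ j ∈ Finset.range k, c j =
      ∑ j ∈ Finset.range k, (∏ i ∈ Finset.range j, c i) * (1 - c j) := by
  induction k with
  | zero => simp
  | succ k ih => rw [Finset.prod_range_succ, Finset.sum_range_succ, ← ih]; ring

/-- The Möbius coordinate `sin (π (x - α)) / sin (π (x + α))` on the circle, which is negative
for `|x| < α` and positive for `α < x < 1 - α`. -/
noncomputable def sinRatio (α x : ℝ) : ℝ :=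
  Real.sin (Real.pi * (x - α)) / Real.sin (Real.pi * (x + α))

/-- In the coordinate `sinRatio α`, `1 / sin (π (f - x))` is a Cauchy kernel up to separated
factors. -/
lemma sinRatio_sub {α x f : ℝ} (hx : Real.sin (Real.pi * (x + α)) ≠ 0)
    (hf : Real.sin (Real.pi * (f + α)) ≠ 0) :
    sinRatio α f - sinRatio α x = Real.sin (2 * Real.pi * α) * Real.sin (Real.pi * (f - x)) /
      (Real.sin (Real.pi * (x + α)) * Real.sin (Real.pi * (f + α))) := by
  have key : Real.sin (Real.pi * (f - α)) * Real.sin (Real.pi * (x + α)) -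
      Real.sin (Real.pi * (x - α)) * Real.sin (Real.pi * (f + α)) =
      Real.sin (2 * Real.pi * α) * Real.sin (Real.pi * (f - x)) := by
    rw [show 2 * Real.pi * α = 2 * (Real.pi * α) by ring]
    simp only [mul_sub, mul_add, Real.sin_sub, Real.sin_add, Real.sin_two_mul]
    ring
  rw [sinRatio, sinRatio, div_sub_div _ _ hf hx, ← key]
  congr 1 <;> ring

/-- Multiplied by `1 - ∏ (μ x - p) / (μ x + p) · (μ f + p) / (μ f - p)`, over `k` points `p`, the
Dirichlet kernel has rank `k`. -/
lemma exists_dirichlet_mul_one_sub_eq_sum (N : ℕ) (α : ℝ) {p : ℕ → ℝ} (hp : ∀ j, 0 < p j) :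
    ∃ c g : ℕ → ℝ → ℂ, ∀ (k : ℕ) (n : ℤ) (x f : ℝ), N * x = n →
      Real.sin (Real.pi * (x + α)) ≠ 0 → Real.sin (Real.pi * (f + α)) ≠ 0 →
      0 < sinRatio α x → sinRatio α f < 0 →
      dirichlet N x f * ((1 - (∏ j ∈ Finset.range k, (sinRatio α x - p j) / (sinRatio α x + p j)) *
        ∏ j ∈ Finset.range k, (sinRatio α f + p j) / (sinRatio α f - p j) : ℝ) : ℂ) =
      ∑ j ∈ Finset.range k, c j x * g j f := by
  refine ⟨fun j x => ((((∏ i ∈ Finset.range j, (sinRatio α x - p i) / (sinRatio α x + p i)) *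
      (1 / (Real.sin (Real.pi * (x + α)) * (sinRatio α x + p j))) : ℝ) : ℂ)) *
        Complex.exp (Real.pi * Complex.I * x),
    fun j f => (((∏ i ∈ Finset.range j, (sinRatio α f + p i) / (sinRatio α f - p i)) *
      (2 * p j * Real.sin (2 * Real.pi * α) /
        (Real.sin (Real.pi * (f + α)) * (sinRatio α f - p j))) : ℝ) : ℂ) *
        (Complex.exp (-(Real.pi * Complex.I * f)) *
          (Complex.exp (2 * Real.pi * Complex.I * f * N) - 1) / (2 * Complex.I)),
    fun k n x f hn hx hf hμx hμf => ?_⟩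
  rw [← Finset.prod_mul_distrib, one_sub_prod_range, Complex.ofReal_sum, Finset.mul_sum]
  refine Finset.sum_congr rfl fun j _ => ?_
  have h1 : sinRatio α x + p j ≠ 0 := by linarith [hp j]
  have h2 : sinRatio α f - p j ≠ 0 := by linarith [hp j]
  -- The numerator is `2 p (μ f - μ x)`, which supplies the `sin (π (f - x))` that cancels the
  -- denominator of the Dirichlet kernel. Each `j` thus leaves a single separated term.
  have h3 : 1 - (sinRatio α x - p j) / (sinRatio α x + p j) *
      ((sinRatio α f + p j) / (sinRatio α f - p j)) =
      Real.sin (Real.pi * (f - x)) * ((1 / (Real.sin (Real.pi * (x + α)) * (sinRatio α x + p j))) *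
      (2 * p j * Real.sin (2 * Real.pi * α) /
        (Real.sin (Real.pi * (f + α)) * (sinRatio α f - p j)))) := by
    have : 1 - (sinRatio α x - p j) / (sinRatio α x + p j) *
      ((sinRatio α f + p j) / (sinRatio α f - p j)) = 2 * p j * (sinRatio α f - sinRatio α x) /
      ((sinRatio α x + p j) * (sinRatio α f - p j)) := by field_simp; ring
    rw [this, sinRatio_sub hx hf]
    field_simp
  rw [h3, Finset.prod_mul_distrib]
  have h4 := dirichlet_mul_sin n x f hn
  push_cast at h4 ⊢
  linear_combination (∏ i ∈ Finset.range j, ((sinRatio α x : ℂ) - p i) / (sinRatio α x + p i)) *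
    (∏ i ∈ Finset.range j, ((sinRatio α f : ℂ) + p i) / (sinRatio α f - p i)) *
    ((1 / (Complex.sin (Real.pi * (x + α)) * (sinRatio α x + p j))) *
      (2 * p j * Complex.sin (2 * Real.pi * α) /
        (Complex.sin (Real.pi * (f + α)) * (sinRatio α f - p j)))) * h4

/-! ### Orthonormality of the normalized DFT vectors -/

lemma dirichlet_self (N : ℕ) (x : ℝ) : dirichlet N x x = N := by
  have : ∀ m : Fin N, star (expVec N x) m * expVec N x m = 1 := fun m => by
    rw [mul_comm, Pi.star_apply, RCLike.star_def, expVec_mul_conj]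
    simp
  rw [dirichlet, trigPoly, Finset.sum_congr rfl fun m _ => this m]
  simp

/-- The numerator of the geometric sum vanishes at `b / N`, while `0 < |b - a| < N` keeps the sine
nonzero. -/
lemma dirichlet_div_eq_zero {N : ℕ} (hN : 1 ≤ N) {a b : ℤ} (hab : a ≠ b) (h : |b - a| < N) :
    dirichlet N ((a : ℝ) / N) ((b : ℝ) / N) = 0 := by
  have hN' : (N : ℝ) ≠ 0 := by positivity
  have hNc : (N : ℂ) ≠ 0 := by exact_mod_cast hN'
  have h1 := dirichlet_mul_sin (N := N) a (a / N) (b / N) (by field_simp)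
  have h2 : Complex.exp (2 * Real.pi * Complex.I * ((b / N : ℝ) : ℂ) * N) = 1 := by
    rw [Complex.exp_eq_one_iff]
    exact ⟨b, by push_cast; field_simp⟩
  rw [h2, sub_self, mul_zero, zero_div, mul_zero] at h1
  refine (mul_eq_zero.1 h1).resolve_right fun h3 => ?_
  rw [Complex.ofReal_eq_zero, Real.sin_eq_zero_iff] at h3
  obtain ⟨n, hn⟩ := h3
  have h4 : b - a = n * N := by
    have : (n : ℝ) = (b - a) / N := by
      have := Real.pi_pos
      field_simp at hn ⊢
      linarith
    rw [eq_div_iff hN'] at this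
    exact_mod_cast this.symm
  rcases eq_or_ne n 0 with rfl | hn0
  · exact hab (by linarith)
  · rw [h4, abs_mul, Nat.abs_cast] at h
    have := Int.one_le_abs hn0
    nlinarith

lemma sum_conj_mul_normalized (N : ℕ) (x f : ℝ) :
    ∑ m, conj (((1 / Real.sqrt N : ℝ) : ℂ) * expVec N x m) *
      (((1 / Real.sqrt N : ℝ) : ℂ) * expVec N f m) = (1 / N : ℂ) * dirichlet N x f := by
  have h : ((1 / Real.sqrt N : ℝ) : ℂ) * ((1 / Real.sqrt N : ℝ) : ℂ) = 1 / N := by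
    rw [← Complex.ofReal_mul, div_mul_div_comm, Real.mul_self_sqrt (by positivity)]
    simp
  rw [dirichlet, trigPoly, Finset.mul_sum, ← h]
  refine Finset.sum_congr rfl fun m _ => ?_
  rw [map_mul, Complex.conj_ofReal, Pi.star_apply, RCLike.star_def]
  ring

lemma two_mul_floor_add_one_le {N : ℕ} (hN : 1 ≤ N) {W : ℝ} (hW : W ∈ Set.Ioo (0 : ℝ) (1 / 2)) :
    2 * ⌊(N : ℝ) * W⌋₊ + 1 ≤ N := by
  have hN' : (1 : ℝ) ≤ N := by exact_mod_cast hN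
  have h := Nat.floor_le (show 0 ≤ (N : ℝ) * W by have := hW.1; positivity)
  have : (2 * (⌊(N : ℝ) * W⌋₊ : ℝ)) < N := by nlinarith [hW.2]
  have : 2 * ⌊(N : ℝ) * W⌋₊ < N := by exact_mod_cast this
  omega

section DFT

variable {N : ℕ} {W : ℝ}

lemma lowDFT_conjTranspose_mul_self (hN : 1 ≤ N) (hW : W ∈ Set.Ioo (0 : ℝ) (1 / 2)) :
    (lowDFT N W)ᴴ * lowDFT N W = 1 := by
  have hf := two_mul_floor_add_one_le hN hW
  have hNc : (N : ℂ) ≠ 0 := by exact_mod_cast (show N ≠ 0 by omega)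
  ext i j
  simp only [Matrix.mul_apply, Matrix.conjTranspose_apply, lowDFT, Matrix.of_apply, RCLike.star_def]
  rw [sum_conj_mul_normalized]
  by_cases h : i = j
  · subst h; simp [dirichlet_self, hNc]
  · have := dirichlet_div_eq_zero hN (a := (i : ℤ) - ⌊(N : ℝ) * W⌋₊) (b := (j : ℤ) - ⌊(N : ℝ) * W⌋₊)
      (by have := Fin.val_ne_of_ne h; omega) (by rw [abs_lt]; omega)
    push_cast at this
    rw [this, mul_zero, Matrix.one_apply_ne h]

lemma highDFT_conjTranspose_mul_self (hN : 1 ≤ N) :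
    (highDFT N W)ᴴ * highDFT N W = 1 := by
  have hNc : (N : ℂ) ≠ 0 := by exact_mod_cast (show N ≠ 0 by omega)
  ext i j
  simp only [Matrix.mul_apply, Matrix.conjTranspose_apply, highDFT, Matrix.of_apply,
    RCLike.star_def]
  rw [sum_conj_mul_normalized]
  by_cases h : i = j
  · subst h; simp [dirichlet_self, hNc]
  · have hi := i.2
    have hj := j.2
    unfold numHigh at hi hj
    have := dirichlet_div_eq_zero hN (a := ⌊(N : ℝ) * W⌋₊ + 1 + (i : ℤ))
      (b := ⌊(N : ℝ) * W⌋₊ + 1 + (j : ℤ))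
      (by have := Fin.val_ne_of_ne h; omega) (by rw [abs_lt]; omega)
    push_cast at this
    rw [this, mul_zero, Matrix.one_apply_ne h]

lemma lowDFT_conjTranspose_mul_highDFT (hN : 1 ≤ N) :
    (lowDFT N W)ᴴ * highDFT N W = 0 := by
  ext i j
  simp only [Matrix.mul_apply, Matrix.conjTranspose_apply, lowDFT, highDFT, Matrix.of_apply,
    RCLike.star_def]
  rw [sum_conj_mul_normalized]
  have hi := i.2
  have hj := j.2
  unfold numHigh at hj
  have := dirichlet_div_eq_zero hN (a := (i : ℤ) - ⌊(N : ℝ) * W⌋₊)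
      (b := ⌊(N : ℝ) * W⌋₊ + 1 + (j : ℤ)) (by omega) (by rw [abs_lt]; omega)
  push_cast at this
  rw [this, mul_zero, Matrix.zero_apply]

lemma highDFT_conjTranspose_mul_lowDFT (hN : 1 ≤ N) :
    (highDFT N W)ᴴ * lowDFT N W = 0 := by
  rw [← Matrix.conjTranspose_conjTranspose (lowDFT N W), ← Matrix.conjTranspose_mul,
    lowDFT_conjTranspose_mul_highDFT hN, Matrix.conjTranspose_zero]

/-- `[F F̄]` has orthonormal columns and is square, so its left inverse is a right inverse. -/
lemma lowDFT_mul_add_highDFT_mul (hN : 1 ≤ N) (hW : W ∈ Set.Ioo (0 : ℝ) (1 / 2)) :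
    lowDFT N W * (lowDFT N W)ᴴ + highDFT N W * (highDFT N W)ᴴ = 1 := by
  have hf := two_mul_floor_add_one_le hN hW
  let e : Fin N ≃ Fin (2 * ⌊(N : ℝ) * W⌋₊ + 1) ⊕ Fin (numHigh N W) :=
    (finSumFinEquiv.trans (finCongr (by unfold numHigh; omega))).symm
  rw [← Matrix.fromCols_mul_fromRows]
  apply (Matrix.mul_eq_one_comm_of_equiv e).2
  rw [Matrix.fromRows_mul_fromCols, lowDFT_conjTranspose_mul_self hN hW,
    highDFT_conjTranspose_mul_self hN, lowDFT_conjTranspose_mul_highDFT hN,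
    highDFT_conjTranspose_mul_lowDFT hN, Matrix.fromBlocks_one]

lemma roast_conjTranspose_mul_self (hN : 1 ≤ N) (hW : W ∈ Set.Ioo (0 : ℝ) (1 / 2)) {r : ℕ}
    {V : Matrix (Fin (numHigh N W)) (Fin r) ℂ} (hV : Vᴴ * V = 1) :
    (roast N W V)ᴴ * roast N W V = 1 := by
  have h1 : (lowDFT N W)ᴴ * (highDFT N W * V) = 0 := by
    rw [← Matrix.mul_assoc, lowDFT_conjTranspose_mul_highDFT hN, Matrix.zero_mul]
  have h2 : (highDFT N W * V)ᴴ * lowDFT N W = 0 := by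
    rw [Matrix.conjTranspose_mul, Matrix.mul_assoc, highDFT_conjTranspose_mul_lowDFT hN,
      Matrix.mul_zero]
  have h3 : (highDFT N W * V)ᴴ * (highDFT N W * V) = 1 := by
    rw [Matrix.conjTranspose_mul, Matrix.mul_assoc, ← Matrix.mul_assoc (highDFT N W)ᴴ,
      highDFT_conjTranspose_mul_self hN, Matrix.one_mul, hV]
  rw [roast, Matrix.conjTranspose_fromCols_eq_fromRows_conjTranspose, Matrix.fromRows_mul_fromCols,
    lowDFT_conjTranspose_mul_self hN hW, h1, h2, h3, Matrix.fromBlocks_one]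

lemma one_sub_roast_mul_conjTranspose (hN : 1 ≤ N) (hW : W ∈ Set.Ioo (0 : ℝ) (1 / 2)) {r : ℕ}
    (V : Matrix (Fin (numHigh N W)) (Fin r) ℂ) :
    1 - roast N W V * (roast N W V)ᴴ = highDFT N W * ((1 - V * Vᴴ) * (highDFT N W)ᴴ) := by
  rw [roast, Matrix.conjTranspose_fromCols_eq_fromRows_conjTranspose, Matrix.fromCols_mul_fromRows,
    ← lowDFT_mul_add_highDFT_mul hN hW, Matrix.conjTranspose_mul, Matrix.sub_mul, Matrix.mul_sub,
    Matrix.one_mul]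
  simp only [Matrix.mul_assoc]
  abel

end DFT

lemma ofReal_norm_toLp_sq {ι : Type*} [Fintype ι] (w : ι → ℂ) :
    ((‖WithLp.toLp 2 w‖ ^ 2 : ℝ) : ℂ) = star w ⬝ᵥ w := by
  rw [EuclideanSpace.norm_sq_eq]
  simp [dotProduct, Complex.conj_mul']

lemma norm_mulVec_of_conjTranspose_mul_self {ι κ : Type*} [Fintype ι] [Fintype κ] [DecidableEq κ]
    {A : Matrix ι κ ℂ} (hA : Aᴴ * A = 1) (v : κ → ℂ) :
    ‖WithLp.toLp 2 (A *ᵥ v)‖ = ‖WithLp.toLp 2 v‖ := by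
  have h1 : ((‖WithLp.toLp 2 (A *ᵥ v)‖ ^ 2 : ℝ) : ℂ) = ((‖WithLp.toLp 2 v‖ ^ 2 : ℝ) : ℂ) := by
    rw [ofReal_norm_toLp_sq, ofReal_norm_toLp_sq, Matrix.star_mulVec, ← Matrix.dotProduct_mulVec,
      Matrix.mulVec_mulVec, hA, Matrix.one_mulVec]
  exact (sq_eq_sq₀ (norm_nonneg _) (norm_nonneg _)).1 (by exact_mod_cast h1)

lemma norm_vecMul_conjTranspose {m n : ℕ} {A : Matrix (Fin m) (Fin n) ℂ} (hA : Aᴴ * A = 1)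
    (y : Fin n → ℂ) : ‖WithLp.toLp 2 (y ᵥ* Aᴴ)‖ = ‖WithLp.toLp 2 y‖ := by
  have h : y ᵥ* Aᴴ = star (A *ᵥ star y) := by rw [Matrix.star_mulVec, star_star]
  rw [h, norm_toLp_star, norm_mulVec_of_conjTranspose_mul_self hA, norm_toLp_star]

lemma norm_conjTranspose_mulVec_le {m n : ℕ} {A : Matrix (Fin m) (Fin n) ℂ} (hA : Aᴴ * A = 1)
    (v : Fin m → ℂ) : ‖WithLp.toLp 2 (Aᴴ *ᵥ v)‖ ≤ ‖WithLp.toLp 2 v‖ := by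
  have h1 : ‖WithLp.toLp 2 (Aᴴ *ᵥ v)‖ ^ 2 ≤ ‖WithLp.toLp 2 v‖ * ‖WithLp.toLp 2 (Aᴴ *ᵥ v)‖ := by
    have h2 := ofReal_norm_toLp_sq (Aᴴ *ᵥ v)
    rw [Matrix.star_mulVec, Matrix.conjTranspose_conjTranspose, ← Matrix.dotProduct_mulVec,
      dotProduct_comm, ← EuclideanSpace.inner_toLp_toLp] at h2
    have h3 := norm_inner_le_norm (𝕜 := ℂ) (WithLp.toLp 2 v) (WithLp.toLp 2 (A *ᵥ (Aᴴ *ᵥ v)))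
    rw [← h2, norm_mulVec_of_conjTranspose_mul_self hA, Complex.norm_real,
      Real.norm_of_nonneg (by positivity)] at h3
    exact h3
  by_contra! h
  nlinarith [norm_nonneg (WithLp.toLp 2 v)]

/-! ### Dominant left singular vectors -/

lemma IsDominantLeftSingularVectors.conjTranspose_mul_self {m n r : ℕ}
    {A : Matrix (Fin m) (Fin n) ℂ} {V : Matrix (Fin m) (Fin r) ℂ}
    (h : IsDominantLeftSingularVectors A V) : Vᴴ * V = 1 := by
  obtain ⟨hr, U, X, σ, hU, -, -, -, -, hV⟩ := h
  have hU1 : Uᴴ * U = 1 := Matrix.mem_unitaryGroup_iff'.1 hU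
  ext i j
  have := congrFun (congrFun hU1 (Fin.castLE hr i)) (Fin.castLE hr j)
  simp only [Matrix.mul_apply, Matrix.conjTranspose_apply, Matrix.one_apply, hV] at this ⊢
  rw [this]
  simp

/-- The residual of the dominant left singular vectors: if a matrix `A` is bounded by `δ` on the
common kernel of `r` functionals, then the part of `A` orthogonal to its `r` dominant left singular
vectors is bounded by `δ`. -/
lemma IsDominantLeftSingularVectors.norm_one_sub_mul_mulVec_le {m n r : ℕ} (hmn : m ≤ n)
    {A : Matrix (Fin m) (Fin n) ℂ} {V : Matrix (Fin m) (Fin r) ℂ}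
    (h : IsDominantLeftSingularVectors A V) {δ : ℝ} (hδ : 0 ≤ δ) (φ : Fin r → Fin m → ℂ)
    (hφ : r < m → ∀ y, (∀ j, φ j ⬝ᵥ y = 0) → ∀ v,
      ‖y ⬝ᵥ (A *ᵥ v)‖ ≤ δ * ‖WithLp.toLp 2 y‖ * ‖WithLp.toLp 2 v‖) (v : Fin n → ℂ) :
    ‖WithLp.toLp 2 (((1 - V * Vᴴ) * A) *ᵥ v)‖ ≤ δ * ‖WithLp.toLp 2 v‖ := by
  obtain ⟨hr, U, X, σ, hU, hX, hσ, hσ0, hA, hV⟩ := h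
  have hU1 : Uᴴ * U = 1 := Matrix.mem_unitaryGroup_iff'.1 hU
  have hU2 : U * Uᴴ = 1 := Matrix.mem_unitaryGroup_iff.1 hU
  have hX1 : Xᴴ * X = 1 := Matrix.mem_unitaryGroup_iff'.1 hX
  have hX2 : X * Xᴴ = 1 := Matrix.mem_unitaryGroup_iff.1 hX
  set D : Matrix (Fin m) (Fin n) ℂ := Matrix.of fun i j =>
    if (i : ℕ) = (j : ℕ) then (σ i : ℂ) else 0 with hD
  have hDv : ∀ (w : Fin n → ℂ) i, (D *ᵥ w) i = σ i * w (Fin.castLE hmn i) := fun w i => by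
    simp only [hD, Matrix.mulVec, dotProduct, Matrix.of_apply, ite_mul, zero_mul]
    rw [Finset.sum_eq_single (Fin.castLE hmn i)]
    · simp
    · intro b _ hb
      rw [if_neg fun h => hb (Fin.ext h.symm)]
    · simp
  -- Min-max, with singular values indexed from `0`. Among combinations of the first `r + 1`
  -- conjugated left singular vectors, a nonzero `y` is killed by all `r` functionals, and the form
  -- restricted to that span is at least `σ r`. The conjugates appear because `⬝ᵥ` is bilinear.
  have hσr : r < m → σ r ≤ δ := by
    intro hrm
    set ι : Fin (r + 1) → Fin m := Fin.castLE hrm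
    have hι : Function.Injective ι := Fin.castLE_injective _
    let L : (Fin (r + 1) → ℂ) →ₗ[ℂ] (Fin r → ℂ) :=
      Matrix.mulVecLin (Matrix.of fun j i => φ j ⬝ᵥ fun a => conj (U a (ι i)))
    obtain ⟨c, hc, hc0⟩ := (Submodule.ne_bot_iff _).1
      (LinearMap.ker_ne_bot_of_finrank_lt (f := L) (by simp))
    set c' : Fin m → ℂ := fun i => if hi : (i : ℕ) < r + 1 then c ⟨i, hi⟩ else 0 with hc'
    have hc'ι : ∀ i, c' (ι i) = c i := fun i => dif_pos i.2
    have hc'0 : ∀ i, i ∉ Set.range ι → c' i = 0 := fun i hi => by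
      rw [hc']
      simp only [dite_eq_right_iff]
      exact fun h => absurd ⟨⟨i, h⟩, Fin.ext rfl⟩ hi
    set y : Fin m → ℂ := c' ᵥ* Uᴴ with hy
    have hyφ : ∀ j, φ j ⬝ᵥ y = 0 := fun j => by
      have h1 := congrFun (LinearMap.mem_ker.1 hc) j
      simp only [L, Matrix.mulVecLin_apply, Matrix.mulVec, Matrix.of_apply, Pi.zero_apply,
        dotProduct] at h1
      rw [← h1]
      simp only [hy, dotProduct, Matrix.vecMul, Matrix.conjTranspose_apply, Finset.mul_sum,
        Finset.sum_mul]
      rw [Finset.sum_comm]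
      symm
      refine Finset.sum_of_injOn ι hι.injOn (by simp) ?_ ?_
      · intro i _ hi
        rw [hc'0 i (by simpa using hi)]; simp
      · intro i _
        simp only [hc'ι, RCLike.star_def]
        exact Finset.sum_congr rfl fun a _ => by ring
    -- Testing against `X *ᵥ w` diagonalizes the form: the pairing becomes `∑ σ i ‖c' i‖²`.
    set w : Fin n → ℂ := fun i => if hi : (i : ℕ) < m then conj (c' ⟨i, hi⟩) else 0 with hw
    have h1 := hφ hrm y hyφ (X *ᵥ w)
    have hwn : ‖WithLp.toLp 2 (X *ᵥ w)‖ = ‖WithLp.toLp 2 c'‖ := by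
      rw [norm_mulVec_of_conjTranspose_mul_self hX1, EuclideanSpace.norm_eq, EuclideanSpace.norm_eq]
      congr 1
      symm
      refine Finset.sum_of_injOn (Fin.castLE hmn) (Fin.castLE_injective _).injOn (by simp) ?_ ?_
      · intro i _ hi
        have : ¬ (i : ℕ) < m := fun h => hi ⟨⟨i, h⟩, by simp, Fin.ext rfl⟩
        simp [hw, this]
      · intro i _
        simp [hw]
    have hyn : ‖WithLp.toLp 2 y‖ = ‖WithLp.toLp 2 c'‖ :=
      norm_vecMul_conjTranspose hU1 c'
    have hval : y ⬝ᵥ (A *ᵥ (X *ᵥ w)) = ((∑ i : Fin m, σ i * ‖c' i‖ ^ 2 : ℝ) : ℂ) := by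
      rw [hA, Matrix.mulVec_mulVec, Matrix.mul_assoc, hX1, Matrix.mul_one, ← Matrix.mulVec_mulVec,
        hy, ← Matrix.dotProduct_mulVec, Matrix.mulVec_mulVec, hU1, Matrix.one_mulVec]
      simp only [dotProduct, hDv]
      push_cast
      refine Finset.sum_congr rfl fun i _ => ?_
      have : w (Fin.castLE hmn i) = conj (c' i) := by simp [hw]
      rw [this, ← Complex.mul_conj']
      ring
    have hlow : σ r * ‖WithLp.toLp 2 c'‖ ^ 2 ≤ ∑ i : Fin m, σ i * ‖c' i‖ ^ 2 := by
      rw [EuclideanSpace.norm_sq_eq, Finset.mul_sum]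
      refine Finset.sum_le_sum fun i _ => ?_
      by_cases hi : (i : ℕ) < r + 1
      · have := hσ (Nat.lt_succ_iff.1 hi)
        gcongr
      · have : c' i = 0 := dif_neg hi
        simp [this]
    rw [hval, hwn, hyn, Complex.norm_real] at h1
    have h3 : σ r * ‖WithLp.toLp 2 c'‖ ^ 2 ≤ δ * ‖WithLp.toLp 2 c'‖ ^ 2 := by
      have := (hlow.trans (Real.le_norm_self _)).trans h1
      linarith
    refine le_of_mul_le_mul_right h3 (pow_pos (norm_pos_iff.2 fun h4 => hc0 ?_) 2)
    ext i
    rw [← hc'ι]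
    exact congrFun (congrArg WithLp.ofLp h4) (ι i)
  -- In the singular basis, `1 - V Vᴴ` keeps exactly the indices `i ≥ r`, where `σ i ≤ σ r ≤ δ`.
  set E : Matrix (Fin m) (Fin m) ℂ := Matrix.diagonal fun i => if (i : ℕ) < r then 0 else 1 with hE
  have hVV : 1 - V * Vᴴ = U * (E * Uᴴ) := by
    rw [← hU2, sub_eq_iff_eq_add]
    ext a b
    have hEU : ∀ i, (E * Uᴴ) i b = (if (i : ℕ) < r then 0 else 1) * star (U b i) := fun i => by
      rw [hE, Matrix.diagonal_mul, Matrix.conjTranspose_apply]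
    rw [Matrix.add_apply, Matrix.mul_apply, Matrix.mul_apply, Matrix.mul_apply]
    simp only [hEU, Matrix.conjTranspose_apply, hV]
    have : ∑ j : Fin r, U a (Fin.castLE hr j) * star (U b (Fin.castLE hr j)) =
        ∑ i : Fin m, U a i * ((if (i : ℕ) < r then 1 else 0) * star (U b i)) := by
      refine Finset.sum_of_injOn (Fin.castLE hr) (Fin.castLE_injective _).injOn (by simp) ?_ ?_
      · intro i _ hi
        have : ¬ (i : ℕ) < r := fun h => hi ⟨⟨i, h⟩, by simp, Fin.ext rfl⟩
        simp [this]
      · intro i _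
        simp
    rw [this, ← Finset.sum_add_distrib]
    refine Finset.sum_congr rfl fun i _ => ?_
    split_ifs <;> simp
  have hmain : ((1 - V * Vᴴ) * A) *ᵥ v = U *ᵥ (E *ᵥ (D *ᵥ (Xᴴ *ᵥ v))) := by
    rw [hVV, hA]
    simp only [Matrix.mulVec_mulVec]
    congr 1
    simp only [Matrix.mul_assoc]
    rw [← Matrix.mul_assoc Uᴴ U, hU1, Matrix.one_mul]
  have hXn : ‖WithLp.toLp 2 (Xᴴ *ᵥ v)‖ = ‖WithLp.toLp 2 v‖ :=
    norm_mulVec_of_conjTranspose_mul_self (by rw [Matrix.conjTranspose_conjTranspose, hX2]) v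
  rw [hmain, norm_mulVec_of_conjTranspose_mul_self hU1, ← hXn]
  refine le_of_sq_le_sq ?_ (by positivity)
  rw [mul_pow, EuclideanSpace.norm_sq_eq, EuclideanSpace.norm_sq_eq, Finset.mul_sum]
  set x := Xᴴ *ᵥ v
  calc ∑ i, ‖(E *ᵥ (D *ᵥ x)) i‖ ^ 2
      ≤ ∑ i : Fin m, δ ^ 2 * ‖x (Fin.castLE hmn i)‖ ^ 2 := by
        refine Finset.sum_le_sum fun i _ => ?_
        rw [hE, Matrix.mulVec_diagonal, hDv]
        by_cases hi : (i : ℕ) < r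
        · simp only [hi, if_true, zero_mul, norm_zero, zero_pow two_ne_zero]
          positivity
        · have h1 : σ i ≤ δ := (hσ (not_lt.1 hi)).trans (hσr ((not_lt.1 hi).trans_lt i.2))
          simp only [hi, if_false, one_mul, norm_mul, Complex.norm_real, mul_pow,
            Real.norm_of_nonneg (hσ0 i)]
          have := hσ0 i
          gcongr
    _ ≤ ∑ i : Fin n, δ ^ 2 * ‖x i‖ ^ 2 := by
        rw [← Finset.sum_image (f := fun i => δ ^ 2 * ‖x i‖ ^ 2) (Fin.castLE_injective hmn).injOn]
        exact Finset.sum_le_univ_sum_of_nonneg fun i => by positivity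

/-! ### The high-frequency part of the prolate matrix -/

lemma one_div_le_sin_pi_mul {N : ℕ} {t : ℝ} (h1 : 1 / (2 * N) ≤ t)
    (h2 : t ≤ 1 - 1 / (2 * N)) : 1 / (N : ℝ) ≤ Real.sin (Real.pi * t) := by
  wlog h : t ≤ 1 / 2 generalizing t
  · have := this (t := 1 - t) (by linarith) (by linarith) (by linarith)
    rwa [mul_sub, mul_one, Real.sin_pi_sub] at this
  have h0 : (0 : ℝ) ≤ 1 / (2 * N) := by positivity
  have h3 := Real.mul_le_sin (x := Real.pi * t) (by have := Real.pi_pos; nlinarith)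
    (by have := Real.pi_pos; nlinarith)
  have h4 : 2 / Real.pi * (Real.pi * t) = 2 * t := by
    have := Real.pi_ne_zero
    field_simp
  have h5 : 1 / (N : ℝ) = 2 * (1 / (2 * N)) := by field_simp
  linarith

lemma div_mem_Icc_of_one_div_le {N : ℕ} (hN : 1 ≤ N) {a b : ℝ} (ha : 1 / (N : ℝ) ≤ a)
    (ha1 : a ≤ 1) (hb : 1 / (N : ℝ) ≤ b) (hb1 : b ≤ 1) : 1 / (N : ℝ) ≤ a / b ∧ a / b ≤ N := by
  have hN0 : (0 : ℝ) < N := by positivity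
  have hb0 : 0 < b := lt_of_lt_of_le (by positivity) hb
  constructor
  · rw [le_div_iff₀ hb0]
    calc 1 / (N : ℝ) * b ≤ 1 / N * 1 := by gcongr
      _ ≤ a := by linarith
  · rw [div_le_iff₀ hb0]
    calc a ≤ 1 := ha1
      _ = N * (1 / N) := by field_simp
      _ ≤ N * b := by gcongr

lemma trigPoly_vecMul_highDFT {N : ℕ} {W : ℝ} (y : Fin (numHigh N W) → ℂ) (f : ℝ) :
    trigPoly (y ᵥ* (highDFT N W)ᴴ) f = ∑ i, y i * (((1 / Real.sqrt N : ℝ) : ℂ) *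
      dirichlet N (((⌊(N : ℝ) * W⌋₊ : ℝ) + 1 + ((i : ℕ) : ℝ)) / N) f) := by
  simp only [trigPoly, dirichlet, Matrix.vecMul, dotProduct, Matrix.conjTranspose_apply, highDFT,
    Matrix.of_apply, Finset.sum_mul, Finset.mul_sum]
  rw [Finset.sum_comm]
  refine Finset.sum_congr rfl fun i _ => Finset.sum_congr rfl fun m _ => ?_
  simp only [RCLike.star_def, map_mul, Complex.conj_ofReal, Pi.star_apply]
  ring

/-- On the common kernel of suitable functionals, `R` of them, the high-frequency part of the
prolate matrix is bounded by `ε ^ (3 / 2)`. -/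
lemma exists_functionals_norm_highDFT_mul_prolate_le {N R : ℕ} (hN : 1 ≤ N) {W ε : ℝ}
    (hW : W ∈ Set.Ioo (0 : ℝ) (1 / 2)) (hε : ε ∈ Set.Ioo (0 : ℝ) (1 / 2))
    (hR : constC N * Real.log (15 / ε) ≤ R) (hRM : R < numHigh N W) :
    ∃ φ : ℕ → Fin (numHigh N W) → ℂ, ∀ y, (∀ j < R, φ j ⬝ᵥ y = 0) → ∀ v,
      ‖y ⬝ᵥ (((highDFT N W)ᴴ * prolate N W) *ᵥ v)‖ ≤
        ε ^ (3 / 4 : ℝ) * (ε ^ (3 / 4 : ℝ)) * ‖WithLp.toLp 2 y‖ * ‖WithLp.toLp 2 v‖ := by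
  -- What matters is `R ≥ 2`: two functionals are reserved for the extreme frequencies and `R - 2`
  -- for the points `p`.
  have hR18 : (18 : ℝ) ≤ R := (constC_mul_log_ge hN hε).trans hR
  have hR18 : 18 ≤ R := by exact_mod_cast hR18
  have hN0 : (0 : ℝ) < N := by positivity
  obtain ⟨p, hp, hpr⟩ := exists_prod_abs_sub_div_add_le (k := R - 2) hN hε (by
    rw [Nat.cast_sub (by omega)]; push_cast; linarith)
  set δ := ε ^ (3 / 4 : ℝ) with hδ
  have hδ0 : 0 ≤ δ := Real.rpow_nonneg hε.1.le _
  -- Halfway between the band edge `W` and `W + 1 / N`: both the band and the inner high frequencies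
  -- stay `1 / (2 N)` away from `±α` modulo `1`, so all sines involved are at least `1 / N`.
  set α := W + 1 / (2 * N) with hα
  set x : Fin (numHigh N W) → ℝ := fun i => ((⌊(N : ℝ) * W⌋₊ : ℝ) + 1 + ((i : ℕ) : ℝ)) / N with hx
  obtain ⟨c, g, hcg⟩ := exists_dirichlet_mul_one_sub_eq_sum N α hp
  have hlt := Nat.lt_floor_add_one ((N : ℝ) * W)
  have hM : 2 * ⌊(N : ℝ) * W⌋₊ + 4 ≤ N := by unfold numHigh at hRM; omega
  have hM' : 2 * (⌊(N : ℝ) * W⌋₊ : ℝ) + 4 ≤ N := by exact_mod_cast hM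
  have hhalf : 1 / (N : ℝ) = 1 / (2 * N) + 1 / (2 * N) := by field_simp; norm_num
  have hinv : 0 < 1 / (2 * (N : ℝ)) := by positivity
  have hW2 : 2 * W + 1 / N ≤ 1 := by
    rw [← sub_nonneg]
    have : 1 - (2 * W + 1 / N) = (N - 2 * (N * W) - 1) / N := by field_simp; ring
    rw [this]
    apply div_nonneg _ hN0.le
    linarith
  -- position of the inner high frequencies
  have hxlow : ∀ i : Fin (numHigh N W), (i : ℕ) ≠ 0 → W + 1 / N ≤ x i := fun i hi => by
    have : (1 : ℝ) ≤ ((i : ℕ) : ℝ) := by exact_mod_cast Nat.one_le_iff_ne_zero.2 hi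
    rw [hx, le_div_iff₀ hN0, add_mul, one_div_mul_cancel hN0.ne']
    linarith
  have hxhigh : ∀ i : Fin (numHigh N W), (i : ℕ) ≠ numHigh N W - 1 → x i ≤ 1 - W - 1 / N :=
    fun i hi => by
      have h1 : ⌊(N : ℝ) * W⌋₊ + 1 + (i : ℕ) + ⌊(N : ℝ) * W⌋₊ + 2 ≤ N := by
        have := i.2
        unfold numHigh at this hi
        omega
      have h2 : (⌊(N : ℝ) * W⌋₊ : ℝ) + 1 + ((i : ℕ) : ℝ) + ⌊(N : ℝ) * W⌋₊ + 2 ≤ N := by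
        exact_mod_cast h1
      rw [hx, div_le_iff₀ hN0, sub_mul, sub_mul, one_div_mul_cancel hN0.ne']
      linarith
  have hfsin : ∀ f ∈ Set.Icc (-W) W, 1 / (N : ℝ) ≤ Real.sin (Real.pi * (f + α)) ∧
      1 / (N : ℝ) ≤ -sinRatio α f ∧ -sinRatio α f ≤ N := fun f hf => by
    have h1 : 1 / (N : ℝ) ≤ Real.sin (Real.pi * (f + α)) :=
      one_div_le_sin_pi_mul (by linarith [hf.1]) (by linarith [hf.2])
    have h2 : 1 / (N : ℝ) ≤ Real.sin (Real.pi * (α - f)) :=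
      one_div_le_sin_pi_mul (by linarith [hf.2]) (by linarith [hf.1])
    have h3 : -sinRatio α f = Real.sin (Real.pi * (α - f)) / Real.sin (Real.pi * (f + α)) := by
      rw [sinRatio, ← neg_div, ← Real.sin_neg]
      congr 2
      ring
    rw [h3]
    exact ⟨h1, div_mem_Icc_of_one_div_le hN h2 (Real.sin_le_one _) h1 (Real.sin_le_one _)⟩
  have hxsin : ∀ i : Fin (numHigh N W), (i : ℕ) ≠ 0 → (i : ℕ) ≠ numHigh N W - 1 →
      1 / (N : ℝ) ≤ Real.sin (Real.pi * (x i + α)) ∧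
      1 / (N : ℝ) ≤ sinRatio α (x i) ∧ sinRatio α (x i) ≤ N := fun i hi hi' => by
    have h3 := hxlow i hi
    have h4 := hxhigh i hi'
    have hW0 := hW.1
    have h1 : 1 / (N : ℝ) ≤ Real.sin (Real.pi * (x i + α)) :=
      one_div_le_sin_pi_mul (by linarith) (by linarith)
    have h2 : 1 / (N : ℝ) ≤ Real.sin (Real.pi * (x i - α)) :=
      one_div_le_sin_pi_mul (by linarith) (by linarith)
    exact ⟨h1, div_mem_Icc_of_one_div_le hN h2 (Real.sin_le_one _) h1 (Real.sin_le_one _)⟩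
  have hinvN : 0 < 1 / (N : ℝ) := by positivity
  set rx : Fin (numHigh N W) → ℝ := fun i =>
    ∏ j ∈ Finset.range (R - 2), (sinRatio α (x i) - p j) / (sinRatio α (x i) + p j) with hrx
  set ρ : ℝ → ℝ := fun f =>
    ∏ j ∈ Finset.range (R - 2), (sinRatio α f + p j) / (sinRatio α f - p j) with hρ
  have hrxδ : ∀ i : Fin (numHigh N W), (i : ℕ) ≠ 0 → (i : ℕ) ≠ numHigh N W - 1 → |rx i| ≤ δ :=
    fun i hi hi' => by
      obtain ⟨-, h2, h3⟩ := hxsin i hi hi'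
      refine le_trans (le_of_eq ?_) (hpr _ h2 h3)
      rw [hrx, Finset.abs_prod]
      refine Finset.prod_congr rfl fun j _ => ?_
      rw [abs_div, abs_of_pos (a := sinRatio α (x i) + p j) (by linarith [hp j])]
  have hρδ : ∀ f ∈ Set.Icc (-W) W, |ρ f| ≤ δ := fun f hf => by
    obtain ⟨-, h2, h3⟩ := hfsin f hf
    refine le_trans (le_of_eq ?_) (hpr _ h2 h3)
    rw [hρ, Finset.abs_prod]
    refine Finset.prod_congr rfl fun j _ => ?_
    rw [abs_div, abs_of_neg (a := sinRatio α f - p j) (by linarith [hp j]), neg_sub,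
      ← abs_neg (sinRatio α f + p j)]
    congr 1
    · congr 1; ring
    · ring
  -- The first two functionals kill the first and last high frequencies, which may lie too close to
  -- the zero or the pole of `sinRatio α`.
  refine ⟨fun j => if j = 0 then Pi.single ⟨0, by omega⟩ 1 else
    if j = 1 then Pi.single ⟨numHigh N W - 1, by omega⟩ 1 else fun i => c (j - 2) (x i),
    fun y hy v => ?_⟩
  have hy0 : ∀ i : Fin (numHigh N W), (i : ℕ) = 0 → y i = 0 := fun i hi => by
    have := hy 0 (by omega)
    simp only [if_true, single_one_dotProduct] at this
    rw [← this]; congr 1; exact Fin.ext hi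
  have hy1 : ∀ i : Fin (numHigh N W), (i : ℕ) = numHigh N W - 1 → y i = 0 := fun i hi => by
    have := hy 1 (by omega)
    simp only [one_ne_zero, if_false, if_true, single_one_dotProduct] at this
    rw [← this]; congr 1; exact Fin.ext hi
  have hyc : ∀ j ∈ Finset.range (R - 2), ∑ i, c j (x i) * y i = 0 := fun j hj => by
    have := hy (j + 2) (by have := Finset.mem_range.1 hj; omega)
    simpa [dotProduct] using this
  set y' : Fin (numHigh N W) → ℂ := fun i => (rx i : ℂ) * y i with hy'
  have hy'n : ‖WithLp.toLp 2 y'‖ ≤ δ * ‖WithLp.toLp 2 y‖ := by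
    refine le_of_sq_le_sq ?_ (by positivity)
    rw [mul_pow, EuclideanSpace.norm_sq_eq, EuclideanSpace.norm_sq_eq, Finset.mul_sum]
    refine Finset.sum_le_sum fun i _ => ?_
    by_cases hi : (i : ℕ) = 0
    · simp [hy', hy0 i hi]
    by_cases hi' : (i : ℕ) = numHigh N W - 1
    · simp [hy', hy1 i hi']
    · simp only [hy', norm_mul, Complex.norm_real, Real.norm_eq_abs, mul_pow]
      have := hrxδ i hi hi'
      gcongr
  have hker : ∀ f ∈ Set.Icc (-W) W, trigPoly (y ᵥ* (highDFT N W)ᴴ) f =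
      (ρ f : ℂ) * trigPoly (y' ᵥ* (highDFT N W)ᴴ) f := fun f hf => by
    obtain ⟨h1, h2, -⟩ := hfsin f hf
    rw [trigPoly_vecMul_highDFT, trigPoly_vecMul_highDFT, ← sub_eq_zero, Finset.mul_sum,
      ← Finset.sum_sub_distrib]
    have h3 : ∀ i : Fin (numHigh N W), y i * (((1 / Real.sqrt N : ℝ) : ℂ) * dirichlet N (x i) f) -
        ρ f * (y' i * (((1 / Real.sqrt N : ℝ) : ℂ) * dirichlet N (x i) f)) =
        ∑ j ∈ Finset.range (R - 2),
          ((1 / Real.sqrt N : ℝ) : ℂ) * g j f * (c j (x i) * y i) := fun i => by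
      by_cases hi : (i : ℕ) = 0
      · simp [hy', hy0 i hi]
      by_cases hi' : (i : ℕ) = numHigh N W - 1
      · simp [hy', hy1 i hi']
      obtain ⟨h4, h5, -⟩ := hxsin i hi hi'
      have h6 := hcg (R - 2) (⌊(N : ℝ) * W⌋₊ + 1 + (i : ℕ)) (x i) f
        (by rw [hx]; push_cast; field_simp) (by linarith) (by linarith) (by linarith) (by linarith)
      have h7 : ∑ j ∈ Finset.range (R - 2),
          ((1 / Real.sqrt N : ℝ) : ℂ) * g j f * (c j (x i) * y i) =
          ((1 / Real.sqrt N : ℝ) : ℂ) * y i * ∑ j ∈ Finset.range (R - 2), c j (x i) * g j f := by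
        rw [Finset.mul_sum]
        exact Finset.sum_congr rfl fun j _ => by ring
      rw [h7, ← h6]
      change _ = ((1 / Real.sqrt N : ℝ) : ℂ) * y i * (dirichlet N (x i) f *
        ((1 - rx i * ρ f : ℝ) : ℂ))
      simp only [hy']
      push_cast
      ring
    rw [Finset.sum_congr rfl fun i _ => h3 i, Finset.sum_comm]
    refine Finset.sum_eq_zero fun j hj => ?_
    rw [← Finset.mul_sum, hyc j hj, mul_zero]
  rw [← Matrix.mulVec_mulVec, Matrix.dotProduct_mulVec]
  have hfin := norm_dotProduct_prolate_mulVec_le hW hδ0 (z := y ᵥ* (highDFT N W)ᴴ)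
    (z' := y' ᵥ* (highDFT N W)ᴴ) (fun f hf => by
      rw [hker f hf, norm_mul, Complex.norm_real, Real.norm_eq_abs]
      gcongr
      exact hρδ f hf) v
  rw [norm_vecMul_conjTranspose (highDFT_conjTranspose_mul_self hN)] at hfin
  refine hfin.trans ?_
  rw [mul_assoc δ δ]
  gcongr

lemma norm_one_sub_mul_highDFT_mul_prolate_mulVec_le {N R : ℕ} (hN : 1 ≤ N) {W ε : ℝ}
    (hW : W ∈ Set.Ioo (0 : ℝ) (1 / 2)) (hε : ε ∈ Set.Ioo (0 : ℝ) (1 / 2))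
    (hR : constC N * Real.log (15 / ε) ≤ R)
    {V : Matrix (Fin (numHigh N W)) (Fin (min R (numHigh N W))) ℂ}
    (hV : IsDominantLeftSingularVectors ((highDFT N W)ᴴ * prolate N W) V) (v : Fin N → ℂ) :
    ‖WithLp.toLp 2 (((1 - V * Vᴴ) * ((highDFT N W)ᴴ * prolate N W)) *ᵥ v)‖ ≤
      ε * Real.sqrt ε * ‖WithLp.toLp 2 v‖ := by
  have hδ : ε ^ (3 / 4 : ℝ) * ε ^ (3 / 4 : ℝ) = ε * Real.sqrt ε := by
    rw [Real.sqrt_eq_rpow, ← Real.rpow_add hε.1, ← Real.rpow_one_add' hε.1.le (by norm_num)]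
    norm_num
  have hδ0 : 0 ≤ ε * Real.sqrt ε := mul_nonneg hε.1.le (Real.sqrt_nonneg _)
  have hMN : numHigh N W ≤ N := by unfold numHigh; omega
  -- If `R ≥ M`, all left singular vectors are kept and the condition on functionals is vacuous.
  by_cases hRM : R < numHigh N W
  · obtain ⟨φ, hφ⟩ := exists_functionals_norm_highDFT_mul_prolate_le hN hW hε hR hRM
    rw [hδ] at hφ
    exact hV.norm_one_sub_mul_mulVec_le hMN hδ0 (fun j => φ j)
      (fun _ y hy => hφ y fun j hj => hy ⟨j, by omega⟩) v
  · exact hV.norm_one_sub_mul_mulVec_le hMN hδ0 0 (fun h => absurd h (by omega)) v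

/-! ### Slepian vectors -/

lemma dtft_timeLimit (N : ℕ) (x : ℤ → ℂ) (f : ℝ) :
    dtft (timeLimit N x) f = ∑ n : Fin N, x ((n : ℕ) : ℤ) * conj (expVec N f n) := by
  have hinj : Function.Injective fun n : Fin N => ((n : ℕ) : ℤ) := fun a b h =>
    Fin.ext (by simpa using h)
  rw [dtft, ← hinj.tsum_eq, tsum_fintype]
  · refine Finset.sum_congr rfl fun n _ => ?_
    rw [timeLimit, if_pos (by have := n.2; omega), expVec, ← Complex.exp_conj]
    congr 2
    simp [Complex.conj_ofNat]
  · intro n hn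
    by_contra h
    refine hn ?_
    have h0 : timeLimit N x n = 0 :=
      if_neg fun hn' => h ⟨⟨n.toNat, by omega⟩, by simp [hn'.1]⟩
    simp only [h0, zero_mul]

/-- On the window the operator is the prolate matrix, so restricting the eigensequences gives its
eigenvectors. -/
lemma bandLimit_timeLimit {N : ℕ} (W : ℝ) (x : ℤ → ℂ) (m : Fin N) :
    bandLimit W (timeLimit N x) ((m : ℕ) : ℤ) =
      (prolate N W *ᵥ fun n => x ((n : ℕ) : ℤ)) m := by
  have h1 : ∀ f : ℝ, dtft (timeLimit N x) f *
      Complex.exp (2 * Real.pi * Complex.I * f * (((m : ℕ) : ℤ) : ℂ)) =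
      ∑ n : Fin N, (expVec N f m * conj (expVec N f n)) * x ((n : ℕ) : ℤ) := fun f => by
    rw [dtft_timeLimit, Finset.sum_mul]
    refine Finset.sum_congr rfl fun n _ => ?_
    simp only [expVec, Int.cast_natCast]
    ring
  simp only [bandLimit, h1]
  have hc : ∀ n : Fin N, Continuous fun f =>
      expVec N f m * conj (expVec N f n) * x ((n : ℕ) : ℤ) := fun n =>
    ((continuous_expVec m).mul (Complex.continuous_conj.comp (continuous_expVec n))).mul
      continuous_const
  rw [intervalIntegral.integral_finsetSum fun n _ => (hc n).intervalIntegrable _ _]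
  simp only [intervalIntegral.integral_mul_const, integral_expVec_mul_conj, Matrix.mulVec,
    dotProduct]

section DPSS

variable {N K : ℕ} {W ε : ℝ} {s : Fin N → ℤ → ℝ} {lam : Fin N → ℝ}

lemma IsDPSS.prolate_mulVec (hs : IsDPSS N W s lam) (ℓ : Fin N) :
    prolate N W *ᵥ dpssVec s ℓ = fun m => (lam ℓ : ℂ) * dpssVec s ℓ m := by
  ext m
  rw [dpssVec, ← hs.eigen ℓ, bandLimit_timeLimit]
  rfl

lemma IsDPSS.dpssMatrix_conjTranspose_mul_self (hs : IsDPSS N W s lam) (hK : K ≤ N) :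
    (dpssMatrix s hK)ᴴ * dpssMatrix s hK = 1 := by
  ext i j
  have h := hs.orthonormal (Fin.castLE hK i) (Fin.castLE hK j)
  simp only [Matrix.mul_apply, Matrix.conjTranspose_apply, dpssMatrix, Matrix.of_apply, dpssVec,
    RCLike.star_def, Complex.conj_ofReal, Matrix.one_apply]
  simp only [(Fin.castLE_injective hK).eq_iff] at h
  simp only [← Complex.ofReal_mul, ← Complex.ofReal_sum, h]
  split_ifs <;> simp

lemma IsDPSS.prolate_mul_dpssMatrix (hs : IsDPSS N W s lam) (hK : K ≤ N) :
    prolate N W * dpssMatrix s hK =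
      dpssMatrix s hK * Matrix.diagonal fun ℓ => (lam (Fin.castLE hK ℓ) : ℂ) := by
  ext m ℓ
  rw [Matrix.mul_diagonal, mul_comm]
  exact congrFun (hs.prolate_mulVec (Fin.castLE hK ℓ)) m

/-- The residual of a vector in the span of the first `K` Slepian vectors. -/
lemma IsDPSS.norm_one_sub_roast_mulVec_le (hs : IsDPSS N W s lam) (hN : 1 ≤ N)
    (hW : W ∈ Set.Ioo (0 : ℝ) (1 / 2)) (hε : ε ∈ Set.Ioo (0 : ℝ) (1 / 2)) (hKN : K ≤ N)
    (hlam : ∀ ℓ : Fin K, ε ≤ lam (Fin.castLE hKN ℓ)) {R : ℕ}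
    (hR : constC N * Real.log (15 / ε) ≤ R)
    {V : Matrix (Fin (numHigh N W)) (Fin (min R (numHigh N W))) ℂ}
    (hV : IsDominantLeftSingularVectors ((highDFT N W)ᴴ * prolate N W) V) (c : Fin K → ℂ) :
    ‖WithLp.toLp 2 ((1 - roast N W V * (roast N W V)ᴴ) *ᵥ (dpssMatrix s hKN *ᵥ c))‖ ≤
      Real.sqrt ε * ‖WithLp.toLp 2 c‖ := by
  have hpos : ∀ ℓ : Fin K, 0 < lam (Fin.castLE hKN ℓ) := fun ℓ => hε.1.trans_le (hlam ℓ)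
  -- Inverting `B` on the span costs a factor `1 / ε`, which reduces `ε ^ (3 / 2)` to `√ε`.
  set d : Fin K → ℂ := fun ℓ => c ℓ / lam (Fin.castLE hKN ℓ) with hd
  have h1 : dpssMatrix s hKN *ᵥ c = prolate N W *ᵥ (dpssMatrix s hKN *ᵥ d) := by
    rw [Matrix.mulVec_mulVec, hs.prolate_mul_dpssMatrix, ← Matrix.mulVec_mulVec]
    congr 1
    ext ℓ
    rw [Matrix.mulVec_diagonal, hd]
    have : (lam (Fin.castLE hKN ℓ) : ℂ) ≠ 0 := by exact_mod_cast (hpos ℓ).ne'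
    field_simp
  have h2 : ε * ‖WithLp.toLp 2 d‖ ≤ ‖WithLp.toLp 2 c‖ := by
    refine le_of_sq_le_sq ?_ (norm_nonneg _)
    rw [mul_pow, EuclideanSpace.norm_sq_eq, EuclideanSpace.norm_sq_eq, Finset.mul_sum]
    refine Finset.sum_le_sum fun ℓ _ => ?_
    have h3 : ‖c ℓ‖ = lam (Fin.castLE hKN ℓ) * ‖d ℓ‖ := by
      have := hpos ℓ
      rw [hd, norm_div, Complex.norm_real, Real.norm_of_nonneg this.le]
      field_simp
    simp only [h3, mul_pow]
    have := hlam ℓ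
    have := hε.1.le
    gcongr
  rw [h1, one_sub_roast_mul_conjTranspose hN hW, Matrix.mulVec_mulVec, Matrix.mul_assoc,
    Matrix.mul_assoc (1 - V * Vᴴ), ← Matrix.mulVec_mulVec,
    norm_mulVec_of_conjTranspose_mul_self (highDFT_conjTranspose_mul_self hN)]
  refine (norm_one_sub_mul_highDFT_mul_prolate_mulVec_le hN hW hε hR hV _).trans ?_
  rw [norm_mulVec_of_conjTranspose_mul_self (hs.dpssMatrix_conjTranspose_mul_self hKN)]
  calc ε * Real.sqrt ε * ‖WithLp.toLp 2 d‖ = Real.sqrt ε * (ε * ‖WithLp.toLp 2 d‖) := by ring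
    _ ≤ _ := by gcongr

end DPSS

/-! ### Column spaces and the subspace angle -/

lemma norm_toLp_single_one {K : ℕ} (ℓ : Fin K) :
    ‖WithLp.toLp 2 (Pi.single ℓ (1 : ℂ) : Fin K → ℂ)‖ = 1 := by
  rw [PiLp.toLp_single, PiLp.norm_single, norm_one]

lemma mem_colSpace_iff {N : ℕ} {ι : Type*} [Fintype ι] (A : Matrix (Fin N) ι ℂ)
    (a : EuclideanSpace ℂ (Fin N)) :
    a ∈ colSpace A ↔ ∃ c : ι → ℂ, WithLp.toLp 2 (A *ᵥ c) = a := by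
  rw [colSpace, Submodule.mem_span_range_iff_exists_fun]
  refine exists_congr fun c => ?_
  have : ∑ i, c i • (WithLp.toLp 2 fun j => A j i : EuclideanSpace ℂ (Fin N)) =
      WithLp.toLp 2 (A *ᵥ c) := by
    ext j
    simp [Matrix.mulVec, dotProduct, mul_comm]
  rw [this]

/-- If every vector of a nonzero subspace `S` is within `√ε` of `T`, relative to its norm, then the
angle between `S` and `T` has cosine at least `√(1 - ε)`. -/
lemma sqrt_one_sub_le_cos_subspaceAngle {N : ℕ} {ε : ℝ} (hε : ε < 1)
    {S T : Submodule ℂ (EuclideanSpace ℂ (Fin N))} (hS : S ≠ ⊥)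
    (h : ∀ a ∈ S, ∃ q ∈ T, ‖a - q‖ ^ 2 ≤ ε * ‖a‖ ^ 2) :
    Real.sqrt (1 - ε) ≤ Real.cos (subspaceAngle S T) := by
  have hP : ∀ a ∈ S, (1 - ε) * ‖a‖ ^ 2 ≤ ‖T.starProjection a‖ ^ 2 := fun a ha => by
    obtain ⟨q, hq, hle⟩ := h a ha
    have h1 : ‖a - T.starProjection a‖ ≤ ‖a - q‖ := by
      rw [Submodule.starProjection_minimal]
      exact ciInf_le ⟨0, by rintro _ ⟨x, rfl⟩; positivity⟩ (⟨q, hq⟩ : T)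
    have h2 := T.norm_sq_eq_add_norm_sq_starProjection a
    rw [Submodule.starProjection_orthogonal_val] at h2
    have h3 : ‖a - T.starProjection a‖ ^ 2 ≤ ‖a - q‖ ^ 2 := by gcongr
    linarith
  -- By `hP` and `ε < 1`, the projection to `T` is injective on `S`; this selects the branch in
  -- `subspaceAngle`.
  have hrank : Module.finrank ℂ S ≤ Module.finrank ℂ T := by
    let L : S →ₗ[ℂ] T := (T.orthogonalProjectionOnto : _ →ₗ[ℂ] T).comp S.subtype
    refine LinearMap.finrank_le_finrank_of_injective (f := L) ?_
    rw [← LinearMap.ker_eq_bot, LinearMap.ker_eq_bot']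
    intro a ha
    have h1 : T.starProjection (a : EuclideanSpace ℂ (Fin N)) = 0 := by
      rw [Submodule.starProjection_apply]
      exact congrArg Subtype.val ha
    have h2 := hP a a.2
    rw [h1, norm_zero] at h2
    have h3 : ‖(a : EuclideanSpace ℂ (Fin N))‖ = 0 := by
      have : ‖(a : EuclideanSpace ℂ (Fin N))‖ ^ 2 ≤ 0 := by nlinarith
      exact pow_eq_zero_iff two_ne_zero |>.1 (le_antisymm this (by positivity))
    exact Subtype.ext (norm_eq_zero.1 h3)
  have hinf : Real.sqrt (1 - ε) ≤ infProj S T := by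
    refine le_csInf ?_ ?_
    · obtain ⟨a, ha, ha0⟩ := (Submodule.ne_bot_iff _).1 hS
      exact ⟨_, ((‖a‖⁻¹ : ℝ) : ℂ) • a, S.smul_mem _ ha, by
        rw [norm_smul, Complex.norm_real, norm_inv, norm_norm,
          inv_mul_cancel₀ (norm_ne_zero_iff.2 ha0)],
        rfl⟩
    · rintro _ ⟨a, ha, ha1, rfl⟩
      refine (Real.sqrt_le_left (norm_nonneg _)).2 ?_
      have := hP a ha
      rwa [ha1, one_pow, mul_one] at this
  rw [subspaceAngle, if_pos hrank]
  -- `Real.arccos` is `0` beyond `1`, so the other case is harmless and `infProj S T ≤ 1` need not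
  -- be proved.
  by_cases h1 : infProj S T ≤ 1
  · rwa [Real.cos_arccos (by linarith [Real.sqrt_nonneg (1 - ε)]) h1]
  · rw [Real.arccos_of_one_le (by linarith), Real.cos_zero]
    obtain ⟨a, ha, ha0⟩ := (Submodule.ne_bot_iff _).1 hS
    have hε0 : 0 ≤ ε := by
      obtain ⟨q, -, hle⟩ := h a ha
      by_contra! hneg
      have : 0 < ‖a‖ ^ 2 := by positivity
      nlinarith [sq_nonneg ‖a - q‖]
    exact Real.sqrt_le_one.2 (by linarith)

end Slepian

open scoped Matrix in
theorem theorem3 (N : ℕ) (W ε : ℝ) (hW : W ∈ Set.Ioo (0 : ℝ) (1 / 2))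
    (hε : ε ∈ Set.Ioo (0 : ℝ) (1 / 2))
    (s : Fin N → ℤ → ℝ) (lam : Fin N → ℝ) (hs : Slepian.IsDPSS N W s lam)
    (K : ℕ) (hK1 : 1 ≤ K) (hKN : K ≤ N) (hK : ε ≤ lam ⟨K - 1, by omega⟩) :
    (∀ V : Matrix (Fin (Slepian.numHigh N W))
        (Fin (min ⌈Slepian.constC N * Real.log (15 / ε)⌉₊ (Slepian.numHigh N W))) ℂ,
      Slepian.IsDominantLeftSingularVectors
        ((Slepian.highDFT N W)ᴴ * Slepian.prolate N W) V →
      (Slepian.roast N W V)ᴴ * Slepian.roast N W V = 1 ∧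
      Slepian.opNorm
        (Slepian.dpssMatrix s hKN * (Slepian.dpssMatrix s hKN)ᴴ -
          Slepian.roast N W V * (Slepian.roast N W V)ᴴ *
            (Slepian.dpssMatrix s hKN * (Slepian.dpssMatrix s hKN)ᴴ)) ^ 2 ≤ ε ∧
      ∀ ℓ : Fin N, (ℓ : ℕ) < K →
        ‖WithLp.toLp 2 (Slepian.dpssVec s ℓ -
          (Slepian.roast N W V * (Slepian.roast N W V)ᴴ) *ᵥ Slepian.dpssVec s ℓ)‖ ^ 2 ≤ ε) ∧
    (∀ V : Matrix (Fin (Slepian.numHigh N W))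
        (Fin (min ⌈Slepian.constC N * Real.log (15 * (N : ℝ) / ε)⌉₊ (Slepian.numHigh N W))) ℂ,
      Slepian.IsDominantLeftSingularVectors
        ((Slepian.highDFT N W)ᴴ * Slepian.prolate N W) V →
      (Slepian.roast N W V)ᴴ * Slepian.roast N W V = 1 ∧
      Real.sqrt (1 - ε) ≤
        Real.cos (Slepian.subspaceAngle
          (Slepian.colSpace (Slepian.dpssMatrix s hKN))
          (Slepian.colSpace (Slepian.roast N W V)))) := by
  have hN : 1 ≤ N := hK1.trans hKN
  have hN' : (1 : ℝ) ≤ N := by exact_mod_cast hN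
  have hε0 := hε.1
  have hlam : ∀ ℓ : Fin K, ε ≤ lam (Fin.castLE hKN ℓ) := fun ℓ =>
    hK.trans (hs.antitone (Fin.le_def.2 (by have := ℓ.2; simp only [Fin.val_castLE]; omega)))
  have hSS := hs.dpssMatrix_conjTranspose_mul_self hKN
  have hsub : ∀ {r : ℕ} (V : Matrix (Fin (Slepian.numHigh N W)) (Fin r) ℂ) (v : Fin N → ℂ),
      v - (Slepian.roast N W V * (Slepian.roast N W V)ᴴ) *ᵥ v =
        (1 - Slepian.roast N W V * (Slepian.roast N W V)ᴴ) *ᵥ v := fun V v => by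
    rw [Matrix.sub_mulVec, Matrix.one_mulVec]
  constructor
  · intro V hV
    have hres := hs.norm_one_sub_roast_mulVec_le hN hW hε hKN hlam (Nat.le_ceil _) hV
    refine ⟨Slepian.roast_conjTranspose_mul_self hN hW hV.conjTranspose_mul_self, ?_, ?_⟩
    · have : Slepian.opNorm (Slepian.dpssMatrix s hKN * (Slepian.dpssMatrix s hKN)ᴴ -
          Slepian.roast N W V * (Slepian.roast N W V)ᴴ *
            (Slepian.dpssMatrix s hKN * (Slepian.dpssMatrix s hKN)ᴴ)) ≤ Real.sqrt ε := by
        refine ContinuousLinearMap.opNorm_le_bound _ (Real.sqrt_nonneg _) fun v => ?_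
        obtain ⟨v, rfl⟩ := (WithLp.toLp_surjective 2) v
        rw [Matrix.toEuclideanCLM_toLp, Matrix.sub_mulVec,
          ← Matrix.mulVec_mulVec v (Slepian.roast N W V * _), hsub, ← Matrix.mulVec_mulVec v]
        refine (hres _).trans ?_
        gcongr
        exact Slepian.norm_conjTranspose_mulVec_le hSS v
      calc _ ≤ Real.sqrt ε ^ 2 := by gcongr; exact norm_nonneg _
        _ = ε := Real.sq_sqrt hε0.le
    · intro ℓ hℓ
      have h1 : Slepian.dpssVec s ℓ = Slepian.dpssMatrix s hKN *ᵥ Pi.single ⟨ℓ, hℓ⟩ 1 := by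
        rw [Matrix.mulVec_single_one]
        rfl
      have h2 := hres (Pi.single ⟨ℓ, hℓ⟩ 1)
      rw [← h1, ← hsub, Slepian.norm_toLp_single_one,
        mul_one] at h2
      calc _ ≤ Real.sqrt ε ^ 2 := by gcongr
        _ = ε := Real.sq_sqrt hε0.le
  · intro V hV
    -- The residual bound is uniform over the span of the DPSS vectors, so the angle needs only the
    -- threshold of the first part, which this larger `R` exceeds.
    have hR : Slepian.constC N * Real.log (15 / ε) ≤
        (⌈Slepian.constC N * Real.log (15 * (N : ℝ) / ε)⌉₊ : ℝ) := by
      refine le_trans ?_ (Nat.le_ceil _)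
      have h1 := Slepian.six_add_le_constC hN
      have h2 := Real.log_nonneg hN'
      refine mul_le_mul_of_nonneg_left (Real.log_le_log (by positivity) ?_) (by linarith)
      gcongr
      linarith
    have hres := hs.norm_one_sub_roast_mulVec_le hN hW hε hKN hlam hR hV
    refine ⟨Slepian.roast_conjTranspose_mul_self hN hW hV.conjTranspose_mul_self, ?_⟩
    refine Slepian.sqrt_one_sub_le_cos_subspaceAngle (by linarith [hε.2]) ?_ ?_
    · rw [Submodule.ne_bot_iff]
      refine ⟨_, (Slepian.mem_colSpace_iff _ _).2 ⟨Pi.single ⟨0, hK1⟩ 1, rfl⟩, ?_⟩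
      rw [← norm_ne_zero_iff, Slepian.norm_mulVec_of_conjTranspose_mul_self hSS,
        Slepian.norm_toLp_single_one]
      exact one_ne_zero
    · intro a ha
      obtain ⟨c, rfl⟩ := (Slepian.mem_colSpace_iff _ _).1 ha
      refine ⟨_, (Slepian.mem_colSpace_iff _ _).2
        ⟨(Slepian.roast N W V)ᴴ *ᵥ (Slepian.dpssMatrix s hKN *ᵥ c), rfl⟩, ?_⟩
      rw [← WithLp.toLp_sub, Matrix.mulVec_mulVec _ (Slepian.roast N W V), hsub,
        Slepian.norm_mulVec_of_conjTranspose_mul_self hSS]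
      calc _ ≤ (Real.sqrt ε * ‖WithLp.toLp 2 c‖) ^ 2 := by gcongr; exact hres c
        _ = ε * ‖WithLp.toLp 2 c‖ ^ 2 := by rw [mul_pow, Real.sq_sqrt hε0.le]
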